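/- **Theorem (moments via characters).** Let $n,k\ge 1$. Let $A_1,\dots,A_n$ be i.i.d. random variables with the uniform distribution $U(0,1)$ and let $(B_1,\dots,B_k)$ be a random vector, independent of $(A_1,\dots,A_n)$, uniformly distributed on $\{(b_1,\dots,b_k): 0\le b_1\le\dots\le b_k\le 1\}$. Let $\Lambda_n$ be the shape of the tableau produced by Robinson–Schensted(–Knuth) row insertion from $(A_1,\dots,A_n)$ and let $\Gamma_{n+k}\supset\Lambda_n$ be the shape produced from the concatenated sequence $(A_1,\dots,A_n,B_1,\dots,B_k)$ (so $(\Lambda_n,\Gamma_{n+k})$ is a Pieri growth pair). Let $u_{n+1},\dots,u_{n+k}$ be the contents (column index minus row index) of the $k$ boxes of $\Gamma_{n+k}\setminus\Lambda_n$, listed in an arbitrary order. Then for every symmetric polynomial $P$ in $k$ variables with complex coefficients, $P(u_{n+1},\dots,u_{n+k})$ is integrable and $$\mathbb{E}\,P(u_{n+1},\dots,u_{n+k})=\left(\chi^{\mathrm{reg}}_{S_n}\otimes\chi^{\mathrm{triv}}_{S_k}\right)\left(P(X_{n+1},\dots,X_{n+k})\big\downarrow^{S_{n+k}}_{S_n\times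 S_k}\right).$$ Here $X_i=(1,i)+\dots+(i-1,i)\in\mathbb{C}[S_{n+k}]$ are the (pairwise commuting) Jucys–Murphy elements; $S_n\times S_k$ is the subgroup of $S_{n+k}$ of the permutations preserving $\{1,\dots,n\}$ and $\{n+1,\dots,n+k\}$; $F\big\downarrow^{S_{n+k}}_{S_n\times S_k}\in\mathbb{C}[S_n\times S_k]$ is the restriction of $F\in\mathbb{C}[S_{n+k}]$, seen as a function on $S_{n+k}$, to this subgroup; $\chi^{\mathrm{reg}}_{S_n}$ and $\chi^{\mathrm{triv}}_{S_k}$ are the normalized characters $g\mapsto \operatorname{Tr}\rho(g)/\dim V$ of the regular representation of $S_n$ and of the one-dimensional trivial representation of $S_k$; $(\chi\otimes\psi)(g,h)=\chi(g)\psi(h)$; and a character is extended linearly to the group algebra by $\chi(f)=\sum_g f(g)\chi(g)$. -/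

import Mathlib

/-! ### Robinson–Schensted insertion and the associated shape -/

namespace PieriGrowth

section RSK

variable {α : Type*} [LinearOrder α]

/-- Row insertion of `x`: `x` replaces the first entry that is larger than `x`, and that entry is
returned as the bumped one; if there is no such entry, `x` is put at the end of the row. -/
def rowInsert (x : α) : List α → List α × Option α
  | [] => ([x], none)
  | y :: r => if x < y then (x :: r, some y) else (y :: (rowInsert x r).1, (rowInsert x r).2)

/-- Insertion of `x` into a tableau (given by the list of its rows): `x` is inserted into the
first row, the entry bumped from a row is inserted into the next one. -/
def tableauInsert : List (List α) → α → List (List α)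
  | [], x => [[x]]
  | r :: T, x =>
    match (rowInsert x r).2 with
    | none => (rowInsert x r).1 :: T
    | some y => (rowInsert x r).1 :: tableauInsert T y

/-- The insertion tableau of a finite sequence. -/
def insertionTableau (l : List α) : List (List α) :=
  l.foldl tableauInsert []

/-- The row `s` may stand directly after the row `r` in a tableau: `s` is not longer than `r`, and
the entries increase strictly along the columns. -/
def Dominates : List α → List α → Prop
  | _, [] => True
  | [], _ :: _ => False
  | a :: r, b :: s => a < b ∧ Dominates r s

theorem Dominates.length_le : ∀ {r s : List α}, Dominates r s → s.length ≤ r.length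
  | _, [], _ => by simp
  | [], _ :: _, h => h.elim
  | _ :: _, _ :: _, h => by simpa using h.2.length_le

theorem rowInsert_bumped_gt (x : α) :
    ∀ (r : List α) {y : α}, (rowInsert x r).2 = some y → x < y
  | [], y, h => by simp [rowInsert] at h
  | a :: r, y, h => by
    by_cases hx : x < a
    · simp only [rowInsert, hx, if_true, Option.some.injEq] at h
      exact h ▸ hx
    · simp only [rowInsert, hx, if_false] at h
      exact rowInsert_bumped_gt x r h

theorem Dominates.rowInsert_left (x : α) :
    ∀ {r s : List α}, Dominates r s → Dominates (rowInsert x r).1 s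
  | _, [], _ => by simp [Dominates]
  | [], _ :: _, h => h.elim
  | a :: r, b :: s, h => by
    by_cases hx : x < a
    · simp only [rowInsert, hx, if_true]
      exact ⟨hx.trans h.1, h.2⟩
    · simp only [rowInsert, hx, if_false]
      exact ⟨h.1, h.2.rowInsert_left x⟩

theorem Dominates.rowInsert_both (x : α) : ∀ {r s : List α} {y : α}, Dominates r s →
    (rowInsert x r).2 = some y → Dominates (rowInsert x r).1 (rowInsert y s).1
  | [], _, y, _, h => by simp [rowInsert] at h
  | a :: r, [], y, _, hy => by
    have hxy := rowInsert_bumped_gt x _ hy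
    by_cases hx : x < a
    · simp [rowInsert, hx, Dominates, hxy]
    · simp only [rowInsert, hx, if_false, Dominates, and_true]
      exact (not_lt.mp hx).trans_lt hxy
  | a :: r, b :: s, y, h, hy => by
    have hxy := rowInsert_bumped_gt x _ hy
    by_cases hx : x < a
    · simp only [rowInsert, hx, if_true, Option.some.injEq] at hy ⊢
      subst hy
      simp only [h.1, if_true]
      exact ⟨hx, h.2⟩
    · simp only [rowInsert, hx, if_false] at hy ⊢
      by_cases hb : y < b
      · simp only [hb, if_true]
        exact ⟨(not_lt.mp hx).trans_lt hxy, h.2.rowInsert_left x⟩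
      · simp only [hb, if_false]
        exact ⟨h.1, h.2.rowInsert_both x hy⟩

theorem isChain_tableauInsert : ∀ (T : List (List α)) (x : α), T.IsChain Dominates →
    (tableauInsert T x).IsChain Dominates
  | [], x, _ => by simp [tableauInsert]
  | r :: T, x, h => by
    unfold tableauInsert
    split
    · cases T with
      | nil => simp
      | cons s T =>
        rw [List.isChain_cons_cons] at h ⊢
        exact ⟨h.1.rowInsert_left x, h.2⟩
    · rename_i y hy
      have ih := isChain_tableauInsert T y h.tail
      cases T with
      | nil =>
        simp only [tableauInsert, List.isChain_cons_cons, List.isChain_singleton, and_true]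
        exact Dominates.rowInsert_both x (s := []) (by cases r <;> trivial) hy
      | cons s T =>
        rw [List.isChain_cons_cons] at h
        have hrs := h.1.rowInsert_both x hy
        unfold tableauInsert at ih ⊢
        split at ih <;> (rw [List.isChain_cons_cons]; exact ⟨hrs, ih⟩)

theorem isChain_insertionTableau (l : List α) : (insertionTableau l).IsChain Dominates := by
  induction l using List.reverseRecOn with
  | nil => simp [insertionTableau]
  | append_singleton l x ih =>
    rw [insertionTableau, List.foldl_append]
    exact isChain_tableauInsert _ x ih

theorem sortedGE_rowLengths (l : List α) :
    ((insertionTableau l).map List.length).SortedGE := by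
  rw [List.sortedGE_iff_isChain, List.isChain_map]
  exact (isChain_insertionTableau l).imp fun _ _ h => h.length_le

/-- The shape associated to a finite sequence: the Young diagram whose rows have the lengths of the
rows of the insertion tableau. As for all of Mathlib's Young diagrams, the box `(i, j)` is in row
`i` and column `j`, counted from `0`. -/
def rskShape (l : List α) : YoungDiagram :=
  YoungDiagram.ofRowLens ((insertionTableau l).map List.length) (sortedGE_rowLengths l)

end RSK

/-- The set of boxes of the skew diagram `Γ ∖ Λ`. -/
def skewBoxes (Λ Γ : YoungDiagram) : Finset (ℕ × ℕ) := Γ.cells \ Λ.cells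

/-- The `u`-coordinate (content) of a box: its column minus its row. -/
def uCoord (c : ℕ × ℕ) : ℤ := (c.2 : ℤ) - (c.1 : ℤ)

section Sanity

variable {α : Type*} [LinearOrder α]

theorem rowInsert_length (x : α) : ∀ r : List α,
    (rowInsert x r).1.length = r.length + (if (rowInsert x r).2 = none then 1 else 0)
  | [] => by simp [rowInsert]
  | a :: r => by
    by_cases hx : x < a
    · simp [rowInsert, hx]
    · simp only [rowInsert, hx, if_false, List.length_cons, rowInsert_length x r]
      omega

theorem tableauInsert_sum : ∀ (T : List (List α)) (x : α),
    ((tableauInsert T x).map List.length).sum = (T.map List.length).sum + 1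
  | [], x => by simp [tableauInsert]
  | r :: T, x => by
    have h := rowInsert_length x r
    unfold tableauInsert
    split <;> rename_i hy
    · simp [h, hy]; omega
    · simp [h, hy, tableauInsert_sum T]; omega

theorem cellsOfRowLens_mono : ∀ (T : List (List α)) (x : α),
    YoungDiagram.cellsOfRowLens (T.map List.length) ⊆
      YoungDiagram.cellsOfRowLens ((tableauInsert T x).map List.length)
  | [], x => by simp [YoungDiagram.cellsOfRowLens]
  | r :: T, x => by
    have h : r.length ≤ (rowInsert x r).1.length := by simp [rowInsert_length x r]
    unfold tableauInsert
    split
    · refine Finset.union_subset_union ?_ subset_rfl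
      gcongr
    · refine Finset.union_subset_union ?_ (Finset.map_subset_map.2 (cellsOfRowLens_mono T _))
      gcongr

theorem card_cellsOfRowLens : ∀ w : List ℕ, (YoungDiagram.cellsOfRowLens w).card = w.sum
  | [] => by simp [YoungDiagram.cellsOfRowLens]
  | a :: w => by
    rw [YoungDiagram.cellsOfRowLens, Finset.card_union_of_disjoint]
    · simp [card_cellsOfRowLens w]
    · rw [Finset.disjoint_left]
      rintro ⟨i, j⟩ h1 h2
      simp at h1 h2
      omega

theorem card_rskShape (l : List α) : (rskShape l).card = l.length := by
  change (YoungDiagram.cellsOfRowLens _).card = _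
  rw [card_cellsOfRowLens]
  induction l using List.reverseRecOn with
  | nil => simp [insertionTableau]
  | append_singleton l x ih =>
    rw [insertionTableau, List.foldl_append] at *
    simpa [tableauInsert_sum] using ih

theorem rskShape_le_append (l l' : List α) : rskShape l ≤ rskShape (l ++ l') := by
  induction l' using List.reverseRecOn with
  | nil => simp
  | append_singleton l' x ih =>
    refine ih.trans ?_
    rw [← List.append_assoc, ← YoungDiagram.cells_subset_iff]
    change YoungDiagram.cellsOfRowLens _ ⊆ YoungDiagram.cellsOfRowLens _
    rw [insertionTableau, insertionTableau, List.foldl_append (l := l ++ l')]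
    exact cellsOfRowLens_mono _ x

/-- The shape grows by exactly as many boxes as there are new letters. -/
theorem card_skewBoxes (l l' : List α) :
    (skewBoxes (rskShape l) (rskShape (l ++ l'))).card = l'.length := by
  have h1 := card_rskShape l
  have h2 := card_rskShape (l ++ l')
  rw [YoungDiagram.card] at h1 h2
  rw [skewBoxes, Finset.card_sdiff_of_subset
    (YoungDiagram.cells_subset_iff.2 (rskShape_le_append l l')), h1, h2]
  simp

end Sanity

/-! ### Jucys–Murphy elements -/

open Equiv in
/-- The Jucys–Murphy element `X_i = ∑_{j < i} (j, i)` in the group algebra. -/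
noncomputable def jucysMurphy {N : ℕ} (i : Fin N) : MonoidAlgebra ℂ (Perm (Fin N)) :=
  ∑ j ∈ Finset.Iio i, MonoidAlgebra.of ℂ (Perm (Fin N)) (swap j i)

theorem commute_jucysMurphy_of_lt {N : ℕ} {i j : Fin N} (h : i < j) :
    Commute (jucysMurphy i) (jucysMurphy j) := by
  refine Commute.sum_left _ _ _ fun a ha => ?_
  have ha : a < i := by simpa using ha
  have key : ∀ b : Fin N, Equiv.swap a i b < j ↔ b < j := fun b => by
    rcases eq_or_ne b a with rfl | h1
    · simp [h, ha.trans h]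
    rcases eq_or_ne b i with rfl | h2
    · simp [h, ha.trans h]
    · rw [Equiv.swap_apply_of_ne_of_ne h1 h2]
  have hj : Equiv.swap a i j = j := Equiv.swap_apply_of_ne_of_ne (ha.trans h).ne' h.ne'
  rw [Commute, SemiconjBy, jucysMurphy, Finset.mul_sum, Finset.sum_mul]
  refine Finset.sum_equiv (Equiv.swap a i) (by simp [key]) fun b _ => ?_
  rw [← map_mul, ← map_mul, Equiv.mul_swap_eq_swap_mul, hj]

/-- The Jucys–Murphy elements commute. -/
theorem commute_jucysMurphy {N : ℕ} (i j : Fin N) :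
    Commute (jucysMurphy i) (jucysMurphy j) := by
  rcases lt_trichotomy i j with h | rfl | h
  · exact commute_jucysMurphy_of_lt h
  · exact Commute.refl _
  · exact (commute_jucysMurphy_of_lt h).symm

/-- The value `P(a₁, …, a_k)` of a polynomial at pairwise commuting elements of an algebra. -/
noncomputable def evalCommuting {k : ℕ} {R : Type*} [Ring R] [Algebra ℂ R] (a : Fin k → R)
    (ha : ∀ i j, Commute (a i) (a j)) (P : MvPolynomial (Fin k) ℂ) : R :=
  ∑ m ∈ P.support, P.coeff m •
    Finset.univ.noncommProd (fun i => a i ^ m i) (fun i _ j _ _ => (ha i j).pow_pow _ _)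

/-- `P(X_{n+1}, …, X_{n+k})` in the group algebra of `S_{n+k}`. -/
noncomputable def evalJucysMurphy (n : ℕ) {k : ℕ} (P : MvPolynomial (Fin k) ℂ) :
    MonoidAlgebra ℂ (Equiv.Perm (Fin (n + k))) :=
  evalCommuting (fun i : Fin k => jucysMurphy (Fin.natAdd n i))
    (fun _ _ => commute_jucysMurphy _ _) P

/-! ### Restriction to `S_n × S_k` and normalized characters -/

/-- The embedding `S_n × S_k → S_{n+k}`: the first factor permutes the first `n` points, the second
factor permutes the last `k` points. -/
def youngEmbedding (n k : ℕ) (g : Equiv.Perm (Fin n) × Equiv.Perm (Fin k)) :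
    Equiv.Perm (Fin (n + k)) :=
  finSumFinEquiv.permCongr (Equiv.Perm.sumCongrHom (Fin n) (Fin k) g)

/-- The restriction of `F`, seen as a function on `S_{n+k}`, to the subgroup `S_n × S_k`. -/
noncomputable def restrictYoung {n k : ℕ} (F : MonoidAlgebra ℂ (Equiv.Perm (Fin (n + k)))) :
    MonoidAlgebra ℂ (Equiv.Perm (Fin n) × Equiv.Perm (Fin k)) :=
  MonoidAlgebra.ofCoeff (Finsupp.equivFunOnFinite.symm fun g => F.coeff (youngEmbedding n k g))

/-- The normalized character `Tr ρ(g) / dim V` of a representation. -/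
noncomputable def normalizedCharacter {G V : Type*} [Monoid G] [AddCommGroup V] [Module ℂ V]
    (ρ : Representation ℂ G V) (g : G) : ℂ :=
  ρ.character g / (Module.finrank ℂ V : ℂ)

/-- The normalized character of the regular representation. -/
noncomputable def chiReg (G : Type*) [Group G] : G → ℂ :=
  normalizedCharacter (Representation.leftRegular ℂ G)

/-- The normalized character of the (one-dimensional) trivial representation. -/
noncomputable def chiTriv (G : Type*) [Group G] : G → ℂ :=
  normalizedCharacter (Representation.trivial ℂ G ℂ)

/-- The tensor product `(χ ⊗ ψ)(g, h) = χ(g) ψ(h)`. -/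
def tensorChar {G H : Type*} (χ : G → ℂ) (ψ : H → ℂ) : G × H → ℂ :=
  fun g => χ g.1 * ψ g.2

/-- The linear extension `χ(f) = ∑_g f(g) χ(g)` to the group algebra. -/
noncomputable def charApply {G : Type*} [Fintype G] (χ : G → ℂ) (f : MonoidAlgebra ℂ G) : ℂ :=
  ∑ g, f.coeff g * χ g

/-! ### The set of ordered vectors in the cube -/

/-- The set `{(b₁, …, b_k) : 0 ≤ b₁ ≤ … ≤ b_k ≤ 1}`. -/
def orderedCube (k : ℕ) : Set (Fin k → ℝ) :=
  {b | (∀ i, b i ∈ Set.Icc (0 : ℝ) 1) ∧ Monotone b}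

end PieriGrowth

open PieriGrowth MeasureTheory ProbabilityTheory

/-!
Young's seminormal representation of `S_N` acts on the functions on standard tableaux with `N`
boxes, encoded as paths in the Young graph. In it the Jucys–Murphy elements act diagonally, by the
contents of the added boxes, and weighting each shape by its number of tableaux turns the trace
into `N!` times the indicator of the identity, the character of the regular representation. Hence,
for `N = n + k`, the right-hand side of the theorem is the weighted trace of `P`, evaluated at
contents, times the symmetrizer of the last `k` points. As `P` is symmetric, its value at contents
depends only on the first `n` steps of a path and its final shape, so only the traces of the
symmetrizer on the blocks of paths sharing these data matter. Each such trace is at least `1` when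
the last `k` boxes form a horizontal strip.

Up to a null set, the relative order of the sample is uniformly distributed on the permutations
increasing on the last `k` points. Robinson–Schensted maps each of them to a recording path whose
last `k` boxes form a horizontal strip, and at most as many permutations share a block as the final
shape has tableaux. The number of permutations in a block is thus at most the weighted trace of the
symmetrizer there. Both add up to `(n + k)! / k!`, so they agree on every block.
-/

namespace PieriGrowth

open Equiv Finset

/-! ### The Coxeter presentation of the symmetric group -/

section Coxeter

variable {M : Type*} [Monoid M] {t : ℕ → M} {N : ℕ}

/-- The Coxeter relations of `S_N` (type `A_{N - 1}`) for the generators `t i` with `i + 1 < N`,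
where `t i` plays the role of the transposition of `i` and `i + 1`. -/
structure IsCoxeterTypeA (N : ℕ) (t : ℕ → M) : Prop where
  mul_self : ∀ i, i + 1 < N → t i * t i = 1
  braid : ∀ i, i + 2 < N → t i * (t (i + 1) * t i) = t (i + 1) * (t i * t (i + 1))
  comm : ∀ i j, i + 1 < j → j + 1 < N → t i * t j = t j * t i

theorem IsCoxeterTypeA.of_succ (h : IsCoxeterTypeA (N + 1) t) : IsCoxeterTypeA N t :=
  ⟨fun i hi => h.mul_self i (by omega), fun i hi => h.braid i (by omega),
    fun i j hi hj => h.comm i j hi (by omega)⟩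

theorem isCoxeterTypeA_swap (N : ℕ) : IsCoxeterTypeA N fun i => swap i (i + 1) := by
  refine ⟨fun i _ => swap_mul_self _ _, fun i _ => ?_, fun i j hij _ => ?_⟩ <;>
  · ext x
    simp only [Perm.mul_apply, swap_apply_def]
    split_ifs <;> omega

/-- The submonoid generated by the `t i` with `i + 1 < N`. -/
def generatedBy (N : ℕ) (t : ℕ → M) : Submonoid M := Submonoid.closure (t '' {i | i + 1 < N})

theorem mem_generatedBy {i : ℕ} (hi : i + 1 < N) : t i ∈ generatedBy N t :=
  Submonoid.subset_closure ⟨i, hi, rfl⟩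

theorem generatedBy_induction {p : M → Prop} (one : p 1)
    (mul : ∀ i, i + 1 < N → ∀ x, p x → p (t i * x)) {x : M} (hx : x ∈ generatedBy N t) : p x := by
  induction hx using Submonoid.closure_induction_left with
  | one => exact one
  | mul_left _ hx y _ ih =>
    obtain ⟨i, hi, rfl⟩ := hx
    exact mul i hi y ih

/-- The representative `t (N - d) * ⋯ * t (N - 1)` of a left coset of `S_N` in `S_{N + 1}`: for
transpositions, the one that maps `N` to `N - d`. -/
def cosetRep (t : ℕ → M) (N : ℕ) : ℕ → M
  | 0 => 1
  | d + 1 => t (N - d - 1) * cosetRep t N d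

theorem IsCoxeterTypeA.mul_cosetRep_of_lt (h : IsCoxeterTypeA (N + 1) t) (i : ℕ) :
    ∀ d, i + 1 + d < N → t i * cosetRep t N d = cosetRep t N d * t i
  | 0, _ => by simp [cosetRep]
  | d + 1, hd => by
    rw [cosetRep, ← mul_assoc, h.comm i (N - d - 1) (by omega) (by omega), mul_assoc,
      h.mul_cosetRep_of_lt i d (by omega), mul_assoc]

theorem IsCoxeterTypeA.mul_cosetRep_of_gt (h : IsCoxeterTypeA (N + 1) t) (i : ℕ) (hi : i < N) :
    ∀ d, d ≤ N → N < i + d → t i * cosetRep t N d = cosetRep t N d * t (i - 1)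
  | 0, _, hd => by omega
  | 1, _, hd => by omega
  | d + 2, hd, hid => by
    by_cases hc : N = i + d + 1
    · obtain ⟨i, rfl⟩ : ∃ j, i = j + 1 := ⟨i - 1, by omega⟩
      have e1 : N - (d + 1) - 1 = i := by omega
      have e2 : N - d - 1 = i + 1 := by omega
      rw [cosetRep, cosetRep, e1, e2, Nat.add_sub_cancel, mul_assoc, mul_assoc,
        ← h.mul_cosetRep_of_lt i d (by omega), ← mul_assoc (t i) (t (i + 1)),
        ← mul_assoc (t (i + 1)), ← h.braid i (by omega)]
      simp only [mul_assoc]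
    · rw [cosetRep, ← mul_assoc, ← h.comm (N - (d + 1) - 1) i (by omega) (by omega), mul_assoc,
        h.mul_cosetRep_of_gt i hi (d + 1) (by omega) (by omega), mul_assoc]

theorem IsCoxeterTypeA.exists_eq_cosetRep_mul (h : IsCoxeterTypeA (N + 1) t) {x : M}
    (hx : x ∈ generatedBy (N + 1) t) :
    ∃ d ≤ N, ∃ y ∈ generatedBy N t, x = cosetRep t N d * y := by
  refine generatedBy_induction (p := fun x => ∃ d ≤ N, ∃ y ∈ generatedBy N t,
    x = cosetRep t N d * y) ⟨0, by simp, 1, one_mem _, by simp [cosetRep]⟩ ?_ hx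
  rintro i hi _ ⟨d, hd, z, hz, rfl⟩
  rcases lt_trichotomy (i + d) N with hlt | heq | hgt
  · by_cases hc : i + d + 1 = N
    · refine ⟨d + 1, by omega, z, hz, ?_⟩
      rw [cosetRep, show N - d - 1 = i by omega, mul_assoc]
    · refine ⟨d, hd, t i * z, mul_mem (mem_generatedBy (by omega)) hz, ?_⟩
      rw [← mul_assoc, h.mul_cosetRep_of_lt i d (by omega), mul_assoc]
  · obtain ⟨d, rfl⟩ : ∃ e, d = e + 1 := ⟨d - 1, by omega⟩
    refine ⟨d, by omega, z, hz, ?_⟩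
    rw [cosetRep, show N - d - 1 = i by omega, ← mul_assoc, ← mul_assoc, h.mul_self i (by omega),
      one_mul]
  · refine ⟨d, hd, t (i - 1) * z, mul_mem (mem_generatedBy (by omega)) hz, ?_⟩
    rw [← mul_assoc, h.mul_cosetRep_of_gt i (by omega) d hd hgt, mul_assoc]

/-- The adjacent transpositions of `ℕ`, each paired with a candidate for its image. The submonoid
that the pairs generate is the graph of the homomorphism to be constructed. -/
def swapPair (t : ℕ → M) (i : ℕ) : Perm ℕ × M := (swap i (i + 1), t i)

theorem isCoxeterTypeA_swapPair (h : IsCoxeterTypeA N t) : IsCoxeterTypeA N (swapPair t) :=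
  ⟨fun i hi => Prod.ext ((isCoxeterTypeA_swap N).mul_self i hi) (h.mul_self i hi),
    fun i hi => Prod.ext ((isCoxeterTypeA_swap N).braid i hi) (h.braid i hi),
    fun i j hi hj => Prod.ext ((isCoxeterTypeA_swap N).comm i j hi hj) (h.comm i j hi hj)⟩

theorem fst_cosetRep_swapPair_apply (t : ℕ → M) (N : ℕ) :
    ∀ d, d ≤ N → (cosetRep (swapPair t) N d).1 N = N - d
  | 0, _ => by simp [cosetRep]
  | d + 1, hd => by
    rw [cosetRep, Prod.fst_mul, Perm.mul_apply, fst_cosetRep_swapPair_apply t N d (by omega),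
      swapPair, show N - d = N - d - 1 + 1 by omega, Nat.add_sub_cancel, swap_apply_right]
    omega

theorem fst_apply_of_mem_generatedBy_swapPair {x : Perm ℕ × M}
    (hx : x ∈ generatedBy N (swapPair t)) {m : ℕ} (hm : N ≤ m) : x.1 m = m := by
  refine generatedBy_induction (p := fun x => x.1 m = m) rfl (fun i hi x ih => ?_) hx
  rw [Prod.fst_mul, Perm.mul_apply, ih]
  exact swap_apply_of_ne_of_ne (by omega) (by omega)

theorem IsCoxeterTypeA.snd_eq_of_fst_eq : ∀ {N : ℕ}, IsCoxeterTypeA N t → ∀ {x y : Perm ℕ × M},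
    x ∈ generatedBy N (swapPair t) → y ∈ generatedBy N (swapPair t) →
    x.1 = y.1 → x.2 = y.2
  | 0, _, x, y, hx, hy, _ => by
    simp only [generatedBy, Nat.not_lt_zero, Set.ofPred_false, Set.image_empty,
      Submonoid.closure_empty, Submonoid.mem_bot] at hx hy
    rw [hx, hy]
  | N + 1, h, x, y, hx, hy, hxy => by
    obtain ⟨d, hd, z, hz, rfl⟩ := (isCoxeterTypeA_swapPair h).exists_eq_cosetRep_mul hx
    obtain ⟨e, he, w, hw, rfl⟩ := (isCoxeterTypeA_swapPair h).exists_eq_cosetRep_mul hy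
    obtain rfl : d = e := by
      have hN := congrArg (fun f => f N) hxy
      simp only [Prod.fst_mul, Perm.mul_apply, fst_apply_of_mem_generatedBy_swapPair hz le_rfl,
        fst_apply_of_mem_generatedBy_swapPair hw le_rfl, fst_cosetRep_swapPair_apply t N _ hd,
        fst_cosetRep_swapPair_apply t N _ he] at hN
      omega
    rw [Prod.snd_mul, Prod.snd_mul, h.of_succ.snd_eq_of_fst_eq hz hw (mul_left_cancel hxy)]

/-- A permutation of `Fin N` seen as a permutation of `ℕ`. -/
def permFinToNat (N : ℕ) : Perm (Fin N) →* Perm ℕ :=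
  Perm.extendDomainHom (Fin.equivSubtype (n := N))

theorem extendDomain_swap {α β : Type*} [DecidableEq α] [DecidableEq β] {p : β → Prop}
    [DecidablePred p] (f : α ≃ Subtype p) (a b : α) :
    (swap a b).extendDomain f = swap (f a : β) (f b) := by
  ext x
  by_cases hx : p x
  · obtain ⟨y, rfl⟩ : ∃ y, (f y : β) = x := ⟨f.symm ⟨x, hx⟩, by simp⟩
    rw [Perm.extendDomain_apply_image, swap_apply_def, swap_apply_def]
    simp only [Subtype.coe_inj, f.injective.eq_iff]
    split_ifs <;> rfl
  · rw [Perm.extendDomain_apply_not_subtype _ _ hx, swap_apply_of_ne_of_ne]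
    · rintro rfl; exact hx (f a).2
    · rintro rfl; exact hx (f b).2

theorem permFinToNat_swap (i j : Fin N) : permFinToNat N (swap i j) = swap (i : ℕ) j :=
  extendDomain_swap Fin.equivSubtype i j

theorem perm_fin_induction {p : Perm (Fin N) → Prop} (one : p 1)
    (mul : ∀ i (hi : i + 1 < N) σ, p σ → p (swap ⟨i, by omega⟩ ⟨i + 1, hi⟩ * σ)) (σ) : p σ := by
  rcases N with _ | N
  · rwa [Subsingleton.elim σ 1]
  · have hσ : σ ∈ Submonoid.closure (Set.range fun i : Fin N ↦ swap i.castSucc i.succ) := by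
      rw [Perm.mclosure_swap_castSucc_succ]
      trivial
    induction hσ using Submonoid.closure_induction_left with
    | one => exact one
    | mul_left x hx y _ ih =>
      obtain ⟨i, rfl⟩ := hx
      exact mul i (by omega) y ih

theorem exists_mem_generatedBy_swapPair (t : ℕ → M) (σ : Perm (Fin N)) :
    ∃ m, (permFinToNat N σ, m) ∈ generatedBy N (swapPair t) := by
  induction σ using perm_fin_induction with
  | one => exact ⟨1, by rw [map_one]; exact one_mem _⟩
  | mul i hi σ ih =>
    obtain ⟨m, hm⟩ := ih
    refine ⟨t i * m, ?_⟩
    rw [map_mul, permFinToNat_swap]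
    simpa only [swapPair, Prod.mk_mul_mk] using mul_mem (mem_generatedBy (t := swapPair t) hi) hm

theorem IsCoxeterTypeA.exists_monoidHom (h : IsCoxeterTypeA N t) : ∃ ρ : Perm (Fin N) →* M,
    ∀ i (hi : i + 1 < N), ρ (swap ⟨i, by omega⟩ ⟨i + 1, hi⟩) = t i := by
  choose ρ hρ using exists_mem_generatedBy_swapPair (N := N) t
  have ρ_eq {σ m} (hm : (permFinToNat N σ, m) ∈ generatedBy N (swapPair t)) :
      ρ σ = m := h.snd_eq_of_fst_eq (hρ σ) hm rfl
  refine ⟨{ toFun := ρ, map_one' := ρ_eq ?_, map_mul' := fun σ τ => ρ_eq ?_ },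
    fun i hi => ρ_eq ?_⟩
  · rw [map_one]
    exact one_mem _
  · rw [map_mul]
    simpa only [Prod.mk_mul_mk] using mul_mem (hρ σ) (hρ τ)
  · rw [permFinToNat_swap]
    exact mem_generatedBy hi

end Coxeter

/-! ### Paths in the Young graph -/

section Paths

/-- The shape with one more box in row `x`. In this section a shape is the sequence of its row
lengths; it is a Young diagram if this sequence is antitone. -/
def addBox (l : ℕ → ℕ) (x : ℕ) : ℕ → ℕ := Function.update l x (l x + 1)

/-- The shape with one box less in row `x` (unchanged if that row is empty). -/
def removeBox (l : ℕ → ℕ) (x : ℕ) : ℕ → ℕ := Function.update l x (l x - 1)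

/-- A box may be added to row `x` of a Young diagram. -/
abbrev CanAdd (l : ℕ → ℕ) (x : ℕ) : Prop := x = 0 ∨ l x < l (x - 1)

/-- A box may be removed from row `x` of a Young diagram. -/
abbrev CanRemove (l : ℕ → ℕ) (x : ℕ) : Prop := l (x + 1) < l x

variable {l : ℕ → ℕ}

theorem addBox_apply (l : ℕ → ℕ) (x y : ℕ) :
    addBox l x y = if y = x then l x + 1 else l y := Function.update_apply ..

theorem removeBox_apply (l : ℕ → ℕ) (x y : ℕ) :
    removeBox l x y = if y = x then l x - 1 else l y := Function.update_apply ..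

theorem antitone_addBox (hl : Antitone l) {x : ℕ} : Antitone (addBox l x) ↔ CanAdd l x := by
  constructor
  · intro h
    rcases x with _ | x
    · exact Or.inl rfl
    · have hx := h x.le_succ
      simp only [addBox_apply, Nat.succ_eq_add_one, if_true, x.ne_add_one, if_false] at hx
      exact Or.inr (by simpa using hx)
  · refine fun h => antitone_nat_of_succ_le fun j => ?_
    have hj := hl j.le_succ
    simp only [addBox_apply]
    split_ifs <;> grind

theorem antitone_removeBox (hl : Antitone l) {x : ℕ} (hx : CanRemove l x) :
    Antitone (removeBox l x) := by
  refine antitone_nat_of_succ_le fun j => ?_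
  have hj := hl j.le_succ
  simp only [removeBox_apply]
  split_ifs <;> grind

theorem removeBox_addBox (l : ℕ → ℕ) (x : ℕ) : removeBox (addBox l x) x = l := by
  ext y
  simp only [removeBox_apply, addBox_apply]
  grind

theorem addBox_removeBox {x : ℕ} (h : 0 < l x) : addBox (removeBox l x) x = l := by
  ext y
  simp only [removeBox_apply, addBox_apply]
  grind

theorem removeBox_addBox_of_ne {x y : ℕ} (h : x ≠ y) :
    removeBox (addBox l x) y = addBox (removeBox l y) x := by
  ext z
  simp only [removeBox_apply, addBox_apply]
  grind

theorem addBox_right_comm (l : ℕ → ℕ) (x y : ℕ) :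
    addBox (addBox l x) y = addBox (addBox l y) x := by
  ext z
  simp only [addBox_apply]
  grind

theorem canRemove_addBox (hl : Antitone l) (x : ℕ) : CanRemove (addBox l x) x := by
  have hx := hl x.le_succ
  simp only [CanRemove, addBox_apply]
  grind

theorem canAdd_removeBox (hl : Antitone l) {x : ℕ} (hx : CanRemove l x) :
    CanAdd (removeBox l x) x := by
  rw [← antitone_addBox (antitone_removeBox hl hx), addBox_removeBox (by omega)]
  exact hl

theorem canAdd_and_addBox_eq_iff {l' : ℕ → ℕ} (hl : Antitone l) (hl' : Antitone l') {x : ℕ} :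
    CanAdd l x ∧ addBox l x = l' ↔ CanRemove l' x ∧ l = removeBox l' x := by
  constructor
  · rintro ⟨-, rfl⟩
    exact ⟨canRemove_addBox hl x, (removeBox_addBox _ _).symm⟩
  · rintro ⟨hx, rfl⟩
    exact ⟨canAdd_removeBox hl' hx, addBox_removeBox (by omega)⟩

theorem canAdd_and_canRemove_addBox_iff {x y : ℕ} (h : x ≠ y) :
    CanAdd l x ∧ CanRemove (addBox l x) y ↔ CanRemove l y ∧ CanAdd (removeBox l y) x := by
  simp only [CanAdd, CanRemove, addBox_apply, removeBox_apply]
  grind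

/-- The shape after `m` steps of the path whose `i`-th step adds a box to row `w i`. -/
def shapeAt (m : ℕ) (w : ℕ → ℕ) (j : ℕ) : ℕ := Nat.count (fun i => w i = j) m

/-- The box added by the `i`-th step of a path. -/
def stepBox (w : ℕ → ℕ) (i : ℕ) : ℕ × ℕ := (w i, shapeAt i w (w i))

/-- The content of the box added by the `i`-th step of a path. -/
def content (i : ℕ) (w : ℕ → ℕ) : ℤ := uCoord (stepBox w i)

theorem shapeAt_zero (w : ℕ → ℕ) : shapeAt 0 w = 0 := by
  ext
  simp [shapeAt]

theorem shapeAt_succ (m : ℕ) (w : ℕ → ℕ) : shapeAt (m + 1) w = addBox (shapeAt m w) (w m) := by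
  ext j
  rw [addBox_apply, shapeAt, Nat.count_succ]
  by_cases h : w m = j
  · simp [h, shapeAt]
  · simp [h, shapeAt, Ne.symm h]

theorem shapeAt_congr {m : ℕ} {w v : ℕ → ℕ} (h : ∀ i < m, w i = v i) :
    shapeAt m w = shapeAt m v := by
  induction m with
  | zero => simp [shapeAt_zero]
  | succ m ih => rw [shapeAt_succ, shapeAt_succ, ih fun i hi => h i (by omega), h m (by omega)]

theorem shapeAt_mono {m m' : ℕ} (h : m ≤ m') (w : ℕ → ℕ) (j : ℕ) :
    shapeAt m w j ≤ shapeAt m' w j := Nat.count_monotone _ h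

theorem shapeAt_update {m N : ℕ} (h : m ≤ N) (w : ℕ → ℕ) (x : ℕ) :
    shapeAt m (Function.update w N x) = shapeAt m w :=
  shapeAt_congr fun _ hi => Function.update_of_ne (by omega) _ _

theorem shapeAt_succ_update (m x : ℕ) (w : ℕ → ℕ) :
    shapeAt (m + 1) (Function.update w m x) = addBox (shapeAt m w) x := by
  rw [shapeAt_succ, Function.update_self, shapeAt_update le_rfl]

theorem content_congr {i : ℕ} {w v : ℕ → ℕ} (h : ∀ j ≤ i, w j = v j) :
    content i w = content i v := by
  rw [content, content, stepBox, stepBox, h i le_rfl, shapeAt_congr fun j hj => h j hj.le]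

theorem sum_shapeAt_le (m : ℕ) (w : ℕ → ℕ) (s : Finset ℕ) : ∑ j ∈ s, shapeAt m w j ≤ m := by
  simp only [shapeAt, Nat.count_eq_card_filter_range]
  rw [← card_biUnion fun i _ j _ hij => disjoint_filter.2 fun _ _ hi hj => hij (hi.symm.trans hj)]
  refine (card_le_card (biUnion_subset.2 fun j _ => filter_subset _ _)).trans_eq (card_range m)

theorem le_of_canAdd_shapeAt {m x : ℕ} {w : ℕ → ℕ} (hw : Antitone (shapeAt m w))
    (hx : CanAdd (shapeAt m w) x) : x ≤ m := by
  have one_le : ∀ j ∈ range x, 1 ≤ shapeAt m w j := fun j hj => by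
    rw [mem_range] at hj
    have := hw (show j ≤ x - 1 by omega)
    rcases hx with hx | hx <;> omega
  simpa using (card_nsmul_le_sum _ _ _ one_le).trans (sum_shapeAt_le m w _)

open Classical in
/-- The paths of length `N` in the Young graph that start at the empty shape, equivalently the
standard tableaux with `N` boxes: the box with entry `i` is in row `w i`. The sequence of rows is
continued by `0` after step `N`, which makes it a function on `ℕ`. -/
noncomputable def paths : ℕ → Finset (ℕ → ℕ)
  | 0 => {0}
  | N + 1 => (paths N).biUnion fun w =>
      {x ∈ range (N + 1) | CanAdd (shapeAt N w) x}.image (Function.update w N)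

theorem mem_paths {N : ℕ} {w : ℕ → ℕ} :
    w ∈ paths N ↔ (∀ m ≤ N, Antitone (shapeAt m w)) ∧ ∀ i, N ≤ i → w i = 0 := by
  induction N generalizing w with
  | zero =>
    simp only [paths, mem_singleton, Nat.le_zero, forall_eq, shapeAt_zero, zero_le, true_imp_iff]
    exact ⟨fun h => ⟨antitone_const, fun i => by simp [h]⟩, fun h => funext h.2⟩
  | succ N ih =>
    simp only [paths, mem_biUnion, mem_image, mem_filter, mem_range, ih]
    constructor
    · rintro ⟨v, ⟨hv, hv0⟩, x, ⟨-, hadd⟩, rfl⟩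
      refine ⟨fun m hm => ?_, fun i hi => ?_⟩
      · rcases hm.lt_or_eq with hm | rfl
        · exact shapeAt_update (Nat.lt_succ_iff.1 hm) v x ▸ hv m (by omega)
        · rwa [shapeAt_succ_update, antitone_addBox (hv N le_rfl)]
      · rw [Function.update_of_ne (by omega), hv0 i (by omega)]
    · rintro ⟨hw, hw0⟩
      have hadd : CanAdd (shapeAt N w) (w N) := by
        rw [← antitone_addBox (hw N (by omega)), ← shapeAt_succ]
        exact hw _ le_rfl
      refine ⟨Function.update w N 0, ⟨fun m hm => ?_, fun i hi => ?_⟩, w N, ⟨?_, ?_⟩, by simp⟩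
      · exact shapeAt_update hm w 0 ▸ hw m (by omega)
      · rw [Function.update_apply]
        split_ifs with h
        · rfl
        · exact hw0 i (by omega)
      · exact Nat.lt_succ_of_le (le_of_canAdd_shapeAt (hw N (by omega)) hadd)
      · rwa [shapeAt_update le_rfl]

variable {m N : ℕ} {w : ℕ → ℕ}

theorem antitone_shapeAt (hw : w ∈ paths N) (hm : m ≤ N) : Antitone (shapeAt m w) :=
  (mem_paths.1 hw).1 m hm

theorem canAdd_shapeAt (hw : w ∈ paths N) (hm : m < N) : CanAdd (shapeAt m w) (w m) := by
  rw [← antitone_addBox (antitone_shapeAt hw hm.le), ← shapeAt_succ]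
  exact antitone_shapeAt hw hm

theorem path_apply_le (hw : w ∈ paths N) (hm : m < N) : w m ≤ m :=
  le_of_canAdd_shapeAt (antitone_shapeAt hw hm.le) (canAdd_shapeAt hw hm)

theorem shapeAt_eq_zero (hw : w ∈ paths N) (hm : m ≤ N) {j : ℕ} (hj : m ≤ j) :
    shapeAt m w j = 0 := by
  induction m generalizing j with
  | zero => simp [shapeAt]
  | succ m ih =>
    have := path_apply_le hw hm
    rw [shapeAt_succ, addBox_apply, if_neg (by omega), ih (by omega) (by omega)]

theorem sum_paths_succ {E : Type*} [AddCommMonoid E] (N : ℕ) (G : (ℕ → ℕ) → E) :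
    ∑ w ∈ paths (N + 1), G w = ∑ w ∈ paths N, ∑ x ∈ range (N + 1) with CanAdd (shapeAt N w) x,
      G (Function.update w N x) := by
  classical
  rw [paths, sum_biUnion fun v hv w hw hne => ?_]
  · exact sum_congr rfl fun w _ => by
      rw [sum_image fun x _ y _ h => Function.update_injective _ _ h]
  · rw [Function.onFun, disjoint_left]
    rintro u hu hu'
    obtain ⟨x, -, rfl⟩ := mem_image.1 hu
    obtain ⟨y, -, h⟩ := mem_image.1 hu'
    refine hne (funext fun i => ?_)
    by_cases hi : i = N
    · rw [hi, (mem_paths.1 hv).2 N le_rfl, (mem_paths.1 hw).2 N le_rfl]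
    · simpa [hi] using (congrFun h i).symm

end Paths

/-! ### The differential poset structure of the Young graph -/

section Dimensions

variable {l : ℕ → ℕ} {m B : ℕ}

open Classical in
/-- The number of paths of length `N` from the empty shape to the shape `l`, which is the dimension
of the representation of the symmetric group attached to `l`. -/
noncomputable def numPaths (N : ℕ) (l : ℕ → ℕ) : ℕ := #{w ∈ paths N | shapeAt N w = l}

theorem numPaths_eq_sum [DecidableEq (ℕ → ℕ)] (N : ℕ) (l : ℕ → ℕ) :
    numPaths N l = ∑ w ∈ paths N, if shapeAt N w = l then 1 else 0 := by
  rw [numPaths, card_filter]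
  congr!

theorem numPaths_zero_addBox (l : ℕ → ℕ) (x : ℕ) : numPaths 0 (addBox l x) = 0 := by
  classical
  rw [numPaths, card_eq_zero]
  refine filter_eq_empty_iff.2 fun w _ h => ?_
  simpa [shapeAt_zero, addBox_apply] using congrFun h x

theorem numPaths_succ (hB : m ≤ B) (hl : Antitone l) :
    numPaths (m + 1) l = ∑ y ∈ range (B + 1) with CanRemove l y, numPaths m (removeBox l y) := by
  classical
  simp only [numPaths_eq_sum, sum_paths_succ, shapeAt_succ_update]
  rw [sum_comm (t := paths m)]
  refine sum_congr rfl fun w hw => ?_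
  have hws := antitone_shapeAt hw le_rfl
  rw [← sum_filter, ← sum_filter, filter_filter, filter_filter]
  refine sum_congr (Finset.ext fun x => ?_) fun _ _ => rfl
  simp only [mem_filter, mem_range, canAdd_and_addBox_eq_iff hws hl]
  refine and_congr_left fun hx => ⟨fun h => by omega, fun _ => ?_⟩
  have := le_of_canAdd_shapeAt hws ((canAdd_and_addBox_eq_iff hws hl).2 hx).1
  omega

variable {R : Type*} [CommRing R] (h : ℕ × ℕ → R) (f : (ℕ → ℕ) → R)

/-- The up operator of the Young graph, with every added box weighted by `h`. Only the rows up to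
`B` are taken into account. -/
def upSum (B : ℕ) (h : ℕ × ℕ → R) (f : (ℕ → ℕ) → R) (l : ℕ → ℕ) : R :=
  ∑ x ∈ range (B + 1) with CanAdd l x, h (x, l x) * f (addBox l x)

/-- The down operator of the Young graph, restricted to the rows up to `B`. -/
def downSum (B : ℕ) (f : (ℕ → ℕ) → R) (l : ℕ → ℕ) : R :=
  ∑ y ∈ range (B + 1) with CanRemove l y, f (removeBox l y)

/-- The total weight of the addable boxes minus the total weight of the removable ones. -/
def boundaryWeight (B : ℕ) (h : ℕ × ℕ → R) (l : ℕ → ℕ) : R :=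
  ∑ x ∈ range (B + 1) with CanAdd l x, h (x, l x) -
    ∑ y ∈ range (B + 1) with CanRemove l y, h (y, l y - 1)

theorem upSum_downSum (hl : Antitone l) :
    upSum B h (downSum B f) l =
      downSum B (upSum B h f) l + boundaryWeight B h l * f l := by
  have up_down : upSum B h (downSum B f) l =
      (∑ x ∈ range (B + 1) with CanAdd l x, h (x, l x)) * f l +
        ∑ x ∈ range (B + 1) with CanAdd l x,
          ∑ y ∈ {y ∈ range (B + 1) | CanRemove (addBox l x) y}.erase x,
            h (x, l x) * f (removeBox (addBox l x) y) := by
    rw [upSum, sum_mul, ← sum_add_distrib]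
    refine sum_congr rfl fun x hx => ?_
    rw [downSum, ← add_sum_erase _ _ (mem_filter.2 ⟨(mem_filter.1 hx).1, canRemove_addBox hl x⟩),
      removeBox_addBox, mul_add, mul_sum]
  have down_up : downSum B (upSum B h f) l =
      (∑ y ∈ range (B + 1) with CanRemove l y, h (y, l y - 1)) * f l +
        ∑ y ∈ range (B + 1) with CanRemove l y,
          ∑ x ∈ {x ∈ range (B + 1) | CanAdd (removeBox l y) x}.erase y,
            h (x, removeBox l y x) * f (addBox (removeBox l y) x) := by
    rw [downSum, sum_mul, ← sum_add_distrib]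
    refine sum_congr rfl fun y hy => ?_
    obtain ⟨hyB, hy⟩ := mem_filter.1 hy
    rw [upSum, ← add_sum_erase _ _ (mem_filter.2 ⟨hyB, canAdd_removeBox hl hy⟩),
      addBox_removeBox (by omega), removeBox_apply, if_pos rfl]
  have off_diagonal : ∑ x ∈ range (B + 1) with CanAdd l x,
          ∑ y ∈ {y ∈ range (B + 1) | CanRemove (addBox l x) y}.erase x,
            h (x, l x) * f (removeBox (addBox l x) y) =
        ∑ y ∈ range (B + 1) with CanRemove l y,
          ∑ x ∈ {x ∈ range (B + 1) | CanAdd (removeBox l y) x}.erase y,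
            h (x, removeBox l y x) * f (addBox (removeBox l y) x) := by
    rw [sum_comm' (t' := {y ∈ range (B + 1) | CanRemove l y})
      (s' := fun y => {x ∈ range (B + 1) | CanAdd (removeBox l y) x}.erase y)]
    · refine sum_congr rfl fun y _ => sum_congr rfl fun x hx => ?_
      have hxy := ne_of_mem_erase hx
      rw [removeBox_addBox_of_ne hxy, removeBox_apply, if_neg hxy]
    · intro x y
      have := @canAdd_and_canRemove_addBox_iff l x y
      grind
  rw [up_down, down_up, off_diagonal, boundaryWeight]
  ring

theorem boundaryWeight_eq_sum (hB : l B = 0) :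
    boundaryWeight B h l = h (0, l 0) +
      ∑ y ∈ range B with CanRemove l y, (h (y + 1, l (y + 1)) - h (y, l y - 1)) := by
  simp only [boundaryWeight, sum_filter]
  rw [sum_range_succ', sum_range_succ _ B, if_neg (show ¬ CanRemove l B by omega), add_zero,
    if_pos (Or.inl rfl), add_sub_right_comm, add_comm, ← sum_sub_distrib]
  congr 1
  refine sum_congr rfl fun y _ => ?_
  by_cases hy : CanRemove l y <;> simp [hy, CanAdd]

theorem boundaryWeight_one (hB : l B = 0) : boundaryWeight B (fun _ => (1 : R)) l = 1 := by
  simp [boundaryWeight_eq_sum _ hB]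

theorem boundaryWeight_uCoord (hl : Antitone l) (hB : l B = 0) :
    boundaryWeight B (fun c => (uCoord c : R)) l = 0 := by
  have telescope : ∀ y ∈ range B, (if CanRemove l y then
      ((uCoord (y + 1, l (y + 1)) : R) - (uCoord (y, l y - 1) : R)) else 0) =
        (l (y + 1) : R) - (l y : R) := fun y _ => by
    have hy := hl y.le_succ
    split_ifs with hc
    · have : 1 ≤ l y := by omega
      push_cast [uCoord, Nat.cast_sub this]
      ring
    · rw [show l (y + 1) = l y by rw [Nat.succ_eq_add_one] at hy; omega, sub_self]
  rw [boundaryWeight_eq_sum _ hB, sum_filter, sum_congr rfl telescope,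
    sum_range_sub fun y => (l y : R)]
  simp [uCoord, hB]

/-- From `U D = D U + c` and `f_{m+1} = D f_m` for the dimensions `f_m`, it follows that
`U f_{m+1} = (m + 1) c f_m`, because `U f_0 = 0`. -/
theorem upSum_numPaths_succ {c : R}
    (hc : ∀ l : ℕ → ℕ, Antitone l → l B = 0 → boundaryWeight B h l = c) (hm : m ≤ B)
    (hl : Antitone l) (hB : l B = 0) :
    upSum B h (fun l => (numPaths (m + 1) l : R)) l = (m + 1) * c * numPaths m l := by
  have succ_eq_downSum : ∀ {m}, m ≤ B → ∀ {l}, Antitone l →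
      (numPaths (m + 1) l : R) = downSum B (fun l => (numPaths m l : R)) l := fun hm _ hl => by
    rw [numPaths_succ hm hl, Nat.cast_sum, downSum]
  have up_succ : ∀ {m}, m ≤ B → ∀ {l}, Antitone l → l B = 0 →
      upSum B h (fun l => (numPaths (m + 1) l : R)) l =
        downSum B (upSum B h fun l => (numPaths m l : R)) l + c * numPaths m l :=
    fun hm l hl hB => by
      rw [← hc l hl hB, ← upSum_downSum h _ hl]
      exact sum_congr rfl fun x hx =>
        congrArg _ (succ_eq_downSum hm ((antitone_addBox hl).2 (mem_filter.1 hx).2))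
  induction m generalizing l with
  | zero =>
    rw [up_succ hm hl hB]
    simp [downSum, upSum, numPaths_zero_addBox]
  | succ m ih =>
    have down_up : downSum B (upSum B h fun l => (numPaths (m + 1) l : R)) l =
        (m + 1) * c * numPaths (m + 1) l := by
      rw [succ_eq_downSum (by omega) hl, downSum, downSum, mul_sum]
      refine sum_congr rfl fun y hy => ih (by omega) (antitone_removeBox hl (mem_filter.1 hy).2) ?_
      rw [removeBox_apply]
      split_ifs with hy
      · rw [← hy, hB]
      · exact hB
    rw [up_succ hm hl hB, down_up]
    push_cast
    ring

theorem sum_numPaths_addBox (hm : m ≤ B) (hl : Antitone l) (hB : l B = 0) :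
    ∑ x ∈ range (B + 1) with CanAdd l x, numPaths (m + 1) (addBox l x) =
      (m + 1) * numPaths m l := by
  have dims := upSum_numPaths_succ (fun _ => (1 : ℤ)) (fun _ _ => boundaryWeight_one) hm hl hB
  simp only [upSum, one_mul, mul_one] at dims
  exact_mod_cast dims

/-- The transition measure of a Young diagram is centred. -/
theorem sum_content_mul_numPaths_addBox (hm : m ≤ B) (hl : Antitone l) (hB : l B = 0) :
    ∑ x ∈ range (B + 1) with CanAdd l x,
      (uCoord (x, l x) : R) * numPaths (m + 1) (addBox l x) = 0 := by
  simpa [upSum] using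
    upSum_numPaths_succ (fun c => (uCoord c : R)) (fun _ => boundaryWeight_uCoord) hm hl hB

/-- The sum over the paths of length `N`, each weighted by the dimension of its final shape. -/
noncomputable def plancherelSum (N : ℕ) (G : (ℕ → ℕ) → R) : R :=
  ∑ w ∈ paths N, (numPaths N (shapeAt N w) : R) * G w

variable {N : ℕ} {G : (ℕ → ℕ) → R}

theorem plancherelSum_succ (hG : ∀ w x, G (Function.update w N x) = G w) :
    plancherelSum (N + 1) G = (N + 1) * plancherelSum N G := by
  rw [plancherelSum, sum_paths_succ, plancherelSum, mul_sum]
  refine sum_congr rfl fun w hw => ?_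
  simp only [shapeAt_succ_update, hG]
  rw [← sum_mul, ← mul_assoc, ← Nat.cast_sum, sum_numPaths_addBox le_rfl
    (antitone_shapeAt hw le_rfl) (shapeAt_eq_zero hw le_rfl le_rfl)]
  push_cast
  rfl

theorem plancherelSum_eq_zero_of_le {M : ℕ} (h : M ≤ N)
    (hG : ∀ w m x, M ≤ m → G (Function.update w m x) = G w) (h0 : plancherelSum M G = 0) :
    plancherelSum N G = 0 := by
  induction N, h using Nat.le_induction with
  | base => exact h0
  | succ N hN ih => rw [plancherelSum_succ fun w x => hG w N x hN, ih, mul_zero]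

theorem plancherelSum_content_mul (hG : ∀ w x, G (Function.update w N x) = G w) :
    plancherelSum (N + 1) (fun w => content N w * G w) = 0 := by
  rw [plancherelSum, sum_paths_succ]
  refine sum_eq_zero fun w hw => ?_
  have centred := sum_content_mul_numPaths_addBox (R := R) le_rfl (antitone_shapeAt hw le_rfl)
    (shapeAt_eq_zero hw le_rfl le_rfl)
  rw [← zero_mul (G w), ← centred, sum_mul]
  refine sum_congr rfl fun x _ => ?_
  rw [shapeAt_succ_update, hG, content, stepBox, Function.update_self, shapeAt_update le_rfl]
  ring

theorem plancherelSum_one (N : ℕ) : plancherelSum N (fun _ => (1 : R)) = N.factorial := by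
  induction N with
  | zero => simp [plancherelSum, paths, numPaths, shapeAt_zero]
  | succ N ih =>
    rw [plancherelSum_succ fun _ _ => rfl, ih, Nat.factorial_succ]
    push_cast
    rfl

end Dimensions

/-! ### Young's seminormal form on functions of paths -/

section SwapStep

/-- The path with the steps `i` and `i + 1` interchanged. -/
def swapStep (i : ℕ) (w : ℕ → ℕ) : ℕ → ℕ := w ∘ swap i (i + 1)

variable {i j m N : ℕ} {w : ℕ → ℕ}

theorem swapStep_self (i : ℕ) (w : ℕ → ℕ) : swapStep i w i = w (i + 1) := by simp [swapStep]

theorem swapStep_succ (i : ℕ) (w : ℕ → ℕ) : swapStep i w (i + 1) = w i := by simp [swapStep]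

theorem swapStep_of_ne (h : j ≠ i) (h' : j ≠ i + 1) (w : ℕ → ℕ) : swapStep i w j = w j := by
  rw [swapStep, Function.comp_apply, swap_apply_of_ne_of_ne h h']

theorem swapStep_swapStep (i : ℕ) (w : ℕ → ℕ) : swapStep i (swapStep i w) = w := by
  ext
  simp [swapStep]

theorem swapStep_comm (h : i + 1 < j) (w : ℕ → ℕ) :
    swapStep i (swapStep j w) = swapStep j (swapStep i w) := by
  simp only [swapStep, Function.comp_assoc, ← Perm.coe_mul]
  rw [(isCoxeterTypeA_swap (j + 2)).comm i j h (by omega)]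

theorem swapStep_braid (i : ℕ) (w : ℕ → ℕ) :
    swapStep i (swapStep (i + 1) (swapStep i w)) =
      swapStep (i + 1) (swapStep i (swapStep (i + 1) w)) := by
  have braid := (isCoxeterTypeA_swap (i + 3)).braid i (by omega)
  simp only [swapStep, Function.comp_assoc, ← Perm.coe_mul, mul_assoc] at braid ⊢
  rw [braid]

theorem shapeAt_swapStep_of_le (h : m ≤ i) (w : ℕ → ℕ) :
    shapeAt m (swapStep i w) = shapeAt m w :=
  shapeAt_congr fun _ hj => swapStep_of_ne (by omega) (by omega) w

theorem shapeAt_swapStep_succ (i : ℕ) (w : ℕ → ℕ) :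
    shapeAt (i + 1) (swapStep i w) = addBox (shapeAt i w) (w (i + 1)) := by
  rw [shapeAt_succ, swapStep_self, shapeAt_swapStep_of_le le_rfl]

theorem shapeAt_swapStep_of_gt (h : i + 1 < m) (w : ℕ → ℕ) :
    shapeAt m (swapStep i w) = shapeAt m w := by
  induction m, h using Nat.le_induction with
  | base =>
    rw [shapeAt_succ, shapeAt_swapStep_succ, swapStep_succ, addBox_right_comm, shapeAt_succ,
      shapeAt_succ]
  | succ m hm ih => rw [shapeAt_succ, shapeAt_succ, ih, swapStep_of_ne (by omega) (by omega)]

theorem shapeAt_swapStep_of_ne (h : m ≠ i + 1) (w : ℕ → ℕ) :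
    shapeAt m (swapStep i w) = shapeAt m w := by
  rcases h.lt_or_gt with h | h
  · exact shapeAt_swapStep_of_le (by omega) w
  · exact shapeAt_swapStep_of_gt h w

theorem content_swapStep_of_ne (h : j ≠ i) (h' : j ≠ i + 1) (w : ℕ → ℕ) :
    content j (swapStep i w) = content j w := by
  rw [content, content, stepBox, stepBox, swapStep_of_ne h h', shapeAt_swapStep_of_ne h']

theorem content_swapStep_self (h : w i ≠ w (i + 1)) :
    content i (swapStep i w) = content (i + 1) w := by
  rw [content, content, stepBox, stepBox, swapStep_self, shapeAt_swapStep_of_le le_rfl,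
    shapeAt_succ, addBox_apply, if_neg h.symm]

theorem content_swapStep_succ (h : w i ≠ w (i + 1)) :
    content (i + 1) (swapStep i w) = content i w := by
  rw [content, content, stepBox, stepBox, swapStep_succ, shapeAt_swapStep_succ, addBox_apply,
    if_neg h]

theorem content_succ_of_eq (h : w i = w (i + 1)) : content (i + 1) w = content i w + 1 := by
  rw [content, content, stepBox, stepBox, shapeAt_succ, addBox_apply, ← h, if_pos rfl, uCoord,
    uCoord]
  push_cast
  ring

theorem lt_shapeAt_of_content_eq (hw : w ∈ paths N) (hij : i < j) (hj : j < N)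
    (h : content i w = content j w) :
    shapeAt i w (w i) + 1 < shapeAt j w (w i) ∧ shapeAt i w (w i) < shapeAt j w (w i + 1) := by
  have antitone_i := antitone_shapeAt hw (show i ≤ N by omega)
  have antitone_j := antitone_shapeAt hw hj.le
  have antitone_j' := antitone_shapeAt hw hj
  have diagonal : (shapeAt i w (w i) : ℤ) - w i = shapeAt j w (w j) - w j := h
  have mono : shapeAt i w (w j) ≤ shapeAt j w (w j) := shapeAt_mono hij.le w (w j)
  have mono' : shapeAt (i + 1) w (w i) ≤ shapeAt j w (w i) := shapeAt_mono hij w (w i)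
  rw [shapeAt_succ, addBox_apply, if_pos rfl] at mono'
  rcases lt_trichotomy (w i) (w j) with hlt | heq | hgt
  · have below := antitone_j (show w i + 1 ≤ w j from hlt)
    have right := antitone_j' hlt.le
    rw [shapeAt_succ, addBox_apply, addBox_apply, if_pos rfl, if_neg hlt.ne] at right
    omega
  · rw [← heq] at diagonal
    omega
  · have := antitone_i hgt.le
    omega

theorem content_ne_succ (hw : w ∈ paths N) (hi : i + 1 < N) :
    content i w ≠ content (i + 1) w := fun h => by
  have below := (lt_shapeAt_of_content_eq hw i.lt_succ_self hi h).2
  rw [shapeAt_succ, addBox_apply, if_neg (by omega)] at below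
  exact (antitone_shapeAt hw (show i ≤ N by omega) (w i).le_succ).not_gt below

theorem content_ne_add_two (hw : w ∈ paths N) (hi : i + 2 < N) :
    content i w ≠ content (i + 2) w := fun h => by
  obtain ⟨right, below⟩ := lt_shapeAt_of_content_eq hw (by omega) hi h
  have antitone_i := antitone_shapeAt hw (show i ≤ N by omega) (w i).le_succ
  simp only [shapeAt_succ, addBox_apply] at right below
  grind

end SwapStep

section Coefficients

/-- The diagonal coefficient of the seminormal form, for two consecutive boxes of contents `a` and
`b`. -/
noncomputable def diagCoeff (a b : ℤ) : ℂ := 1 / ((b : ℂ) - a)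

/-- The off-diagonal coefficient of the seminormal form. It vanishes when the two boxes cannot be
interchanged: they are then neighbours in a row or in a column, and their contents differ by `1`. -/
noncomputable def offCoeff (a b : ℤ) : ℂ := if b = a + 1 ∨ a = b + 1 then 0 else 1 - diagCoeff a b

theorem diagCoeff_swap (a b : ℤ) : diagCoeff b a = -diagCoeff a b := by
  rw [diagCoeff, diagCoeff, ← neg_sub, div_neg]

variable {a b c : ℤ}

theorem diagCoeff_mul_sub (h : a ≠ b) : diagCoeff a b * ((b : ℂ) - a) = 1 :=
  one_div_mul_cancel (sub_ne_zero.2 (by exact_mod_cast h.symm))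

theorem diagCoeff_mul (hab : a ≠ b) (hbc : b ≠ c) (hac : a ≠ c) :
    diagCoeff a b * diagCoeff b c = diagCoeff a c * (diagCoeff a b + diagCoeff b c) := by
  have h1 : (b : ℂ) - a ≠ 0 := sub_ne_zero.2 (by exact_mod_cast hab.symm)
  have h2 : (c : ℂ) - b ≠ 0 := sub_ne_zero.2 (by exact_mod_cast hbc.symm)
  have h3 : (c : ℂ) - a ≠ 0 := sub_ne_zero.2 (by exact_mod_cast hac.symm)
  simp only [diagCoeff]
  field_simp
  ring

theorem offCoeff_mul (a b : ℤ) : offCoeff a b * offCoeff b a = 1 - diagCoeff a b ^ 2 := by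
  by_cases h : b = a + 1 ∨ a = b + 1
  · rw [offCoeff, if_pos h]
    rcases h with rfl | rfl <;> simp [diagCoeff]
  · rw [offCoeff, offCoeff, if_neg h, if_neg (by tauto), diagCoeff_swap a b]
    ring

theorem offCoeff_eq_zero_iff : offCoeff a b = 0 ↔ b = a + 1 ∨ a = b + 1 := by
  refine ⟨fun h => ?_, fun h => if_pos h⟩
  by_contra hab
  rw [offCoeff, if_neg hab, sub_eq_zero] at h
  have hne : a ≠ b := fun e => by simp [diagCoeff, e] at h
  have sub_eq_one := diagCoeff_mul_sub hne
  rw [← h, one_mul] at sub_eq_one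
  exact hab (Or.inl (by rw [add_comm]; exact_mod_cast sub_eq_iff_eq_add.1 sub_eq_one))

theorem offCoeff_eq_zero_comm : offCoeff a b = 0 ↔ offCoeff b a = 0 := by
  rw [offCoeff_eq_zero_iff, offCoeff_eq_zero_iff, or_comm]

end Coefficients

section SeminormalOp

variable {i j N : ℕ} {φ : (ℕ → ℕ) → ℂ} {w : ℕ → ℕ}

theorem apply_ne_of_offCoeff_ne_zero (h : offCoeff (content i w) (content (i + 1) w) ≠ 0) :
    w i ≠ w (i + 1) :=
  fun e => h (offCoeff_eq_zero_iff.2 (Or.inl (content_succ_of_eq e)))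

theorem swapStep_mem_paths (hw : w ∈ paths N) (hi : i + 1 < N)
    (h : offCoeff (content i w) (content (i + 1) w) ≠ 0) : swapStep i w ∈ paths N := by
  have hne := apply_ne_of_offCoeff_ne_zero h
  refine mem_paths.2 ⟨fun m hm => ?_, fun j hj => ?_⟩
  · obtain rfl | hm' := eq_or_ne m (i + 1)
    · rw [shapeAt_swapStep_succ, antitone_addBox (antitone_shapeAt hw (by omega))]
      rw [Ne, offCoeff_eq_zero_iff] at h
      have canAdd := canAdd_shapeAt hw hi
      simp only [CanAdd, content, stepBox, uCoord, shapeAt_succ, addBox_apply, hne.symm,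
        if_false] at canAdd h ⊢
      grind
    · rw [shapeAt_swapStep_of_ne hm']
      exact antitone_shapeAt hw hm
  · rw [swapStep_of_ne (by omega) (by omega)]
    exact (mem_paths.1 hw).2 j hj

/-- The action of the transposition `(i, i + 1)` in Young's seminormal form, on functions of
arbitrary sequences `ℕ → ℕ`. -/
noncomputable def seminormalOp (i : ℕ) : Module.End ℂ ((ℕ → ℕ) → ℂ) where
  toFun φ w := diagCoeff (content i w) (content (i + 1) w) * φ w +
    offCoeff (content i w) (content (i + 1) w) * φ (swapStep i w)
  map_add' φ ψ := by
    ext w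
    simp only [Pi.add_apply]
    ring
  map_smul' c φ := by
    ext w
    simp only [Pi.smul_apply, smul_eq_mul, RingHom.id_apply]
    ring

theorem seminormalOp_apply (i : ℕ) (φ : (ℕ → ℕ) → ℂ) (w : ℕ → ℕ) :
    seminormalOp i φ w = diagCoeff (content i w) (content (i + 1) w) * φ w +
      offCoeff (content i w) (content (i + 1) w) * φ (swapStep i w) := rfl

theorem offCoeff_mul_congr {z z' : ℂ} (h : w i ≠ w (i + 1) → z = z') :
    offCoeff (content i w) (content (i + 1) w) * z =
      offCoeff (content i w) (content (i + 1) w) * z' := by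
  by_cases h0 : offCoeff (content i w) (content (i + 1) w) = 0
  · rw [h0, zero_mul, zero_mul]
  · rw [h (apply_ne_of_offCoeff_ne_zero h0)]

theorem seminormalOp_swapStep (φ : (ℕ → ℕ) → ℂ) (h : w i ≠ w (i + 1)) :
    seminormalOp i φ (swapStep i w) =
      diagCoeff (content (i + 1) w) (content i w) * φ (swapStep i w) +
        offCoeff (content (i + 1) w) (content i w) * φ w := by
  rw [seminormalOp_apply, content_swapStep_self h, content_swapStep_succ h, swapStep_swapStep]

theorem seminormalOp_seminormalOp (i : ℕ) (φ : (ℕ → ℕ) → ℂ) :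
    seminormalOp i (seminormalOp i φ) = φ := by
  ext w
  rw [seminormalOp_apply, offCoeff_mul_congr (seminormalOp_swapStep φ), seminormalOp_apply,
    diagCoeff_swap (content i w) (content (i + 1) w)]
  linear_combination (offCoeff_mul (content i w) (content (i + 1) w)) * φ w

theorem content_succ_mul (φ : (ℕ → ℕ) → ℂ) (h : content i w ≠ content (i + 1) w) :
    content (i + 1) w * φ w =
      seminormalOp i (fun v => content i v * seminormalOp i φ v) w + seminormalOp i φ w := by
  have swapped := offCoeff_mul_congr (w := w) (i := i) fun hne =>
    show content i (swapStep i w) * seminormalOp i φ (swapStep i w) = content (i + 1) w *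
        (diagCoeff (content (i + 1) w) (content i w) * φ (swapStep i w) +
          offCoeff (content (i + 1) w) (content i w) * φ w) by
      rw [content_swapStep_self hne, seminormalOp_swapStep φ hne]
  rw [seminormalOp_apply, swapped, seminormalOp_apply,
    diagCoeff_swap (content i w) (content (i + 1) w)]
  linear_combination
    (-content (i + 1) w * φ w) * offCoeff_mul (content i w) (content (i + 1) w) +
    (diagCoeff (content i w) (content (i + 1) w) * φ w +
      offCoeff (content i w) (content (i + 1) w) * φ (swapStep i w)) * diagCoeff_mul_sub h

theorem seminormalOp_comm (h : i + 1 < j) (φ : (ℕ → ℕ) → ℂ) :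
    seminormalOp i (seminormalOp j φ) = seminormalOp j (seminormalOp i φ) := by
  ext w
  simp only [seminormalOp_apply]
  rw [content_swapStep_of_ne (show j ≠ i by omega) (by omega),
    content_swapStep_of_ne (show j + 1 ≠ i by omega) (by omega),
    content_swapStep_of_ne (show i ≠ j by omega) (by omega),
    content_swapStep_of_ne (show i + 1 ≠ j by omega) (by omega), swapStep_comm h]
  ring

theorem seminormalOp_succ_seminormalOp_apply {a b c : ℤ} (ha : content i w = a)
    (hb : content (i + 1) w = b) (hc : content (i + 2) w = c) (φ : (ℕ → ℕ) → ℂ) :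
    seminormalOp (i + 1) (seminormalOp i φ) w =
      diagCoeff b c * (diagCoeff a b * φ w + offCoeff a b * φ (swapStep i w)) +
        offCoeff b c * (diagCoeff a c * φ (swapStep (i + 1) w) +
          offCoeff a c * φ (swapStep i (swapStep (i + 1) w))) := by
  subst ha hb hc
  rw [seminormalOp_apply, seminormalOp_apply i φ w]
  congr 1
  refine offCoeff_mul_congr fun hne => ?_
  rw [seminormalOp_apply, content_swapStep_of_ne (by omega) (by omega), content_swapStep_self hne]

theorem seminormalOp_seminormalOp_succ_apply {a b c : ℤ} (ha : content i w = a)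
    (hb : content (i + 1) w = b) (hc : content (i + 2) w = c) (φ : (ℕ → ℕ) → ℂ) :
    seminormalOp i (seminormalOp (i + 1) φ) w =
      diagCoeff a b * (diagCoeff b c * φ w + offCoeff b c * φ (swapStep (i + 1) w)) +
        offCoeff a b * (diagCoeff a c * φ (swapStep i w) +
          offCoeff a c * φ (swapStep (i + 1) (swapStep i w))) := by
  subst ha hb hc
  rw [seminormalOp_apply, seminormalOp_apply (i + 1) φ w]
  congr 1
  refine offCoeff_mul_congr fun hne => ?_
  rw [seminormalOp_apply, content_swapStep_succ hne,
    content_swapStep_of_ne (j := i + 1 + 1) (by omega) (by omega)]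

/-- Both sides are expanded at `w` in the coefficients of the three contents; the remaining identity
is `diagCoeff_mul`. -/
theorem seminormalOp_braid (φ : (ℕ → ℕ) → ℂ) (h1 : content i w ≠ content (i + 1) w)
    (h2 : content (i + 1) w ≠ content (i + 2) w) (h3 : content i w ≠ content (i + 2) w) :
    seminormalOp i (seminormalOp (i + 1) (seminormalOp i φ)) w =
      seminormalOp (i + 1) (seminormalOp i (seminormalOp (i + 1) φ)) w := by
  have left := offCoeff_mul_congr (w := w) fun hne =>
    seminormalOp_succ_seminormalOp_apply (content_swapStep_self hne) (content_swapStep_succ hne)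
      (content_swapStep_of_ne (j := i + 2) (by omega) (by omega) w) φ
  have right := offCoeff_mul_congr (w := w) fun hne =>
    seminormalOp_seminormalOp_succ_apply
      (content_swapStep_of_ne (i := i + 1) (j := i) (by omega) (by omega) w)
      (content_swapStep_self hne) (content_swapStep_succ hne) φ
  rw [seminormalOp_apply i, left, seminormalOp_succ_seminormalOp_apply rfl rfl rfl,
    seminormalOp_apply (i + 1), right, seminormalOp_seminormalOp_succ_apply rfl rfl rfl,
    swapStep_swapStep, swapStep_swapStep, swapStep_braid]
  have diag := diagCoeff_mul h1 h2 h3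
  have off_ab := offCoeff_mul (content i w) (content (i + 1) w)
  have off_bc := offCoeff_mul (content (i + 1) w) (content (i + 2) w)
  rw [diagCoeff_swap (content i w) (content (i + 1) w),
    diagCoeff_swap (content (i + 1) w) (content (i + 2) w)]
  linear_combination (φ w * diagCoeff (content i w) (content (i + 2) w)) * (off_ab - off_bc) +
    (φ w * (diagCoeff (content i w) (content (i + 1) w) -
        diagCoeff (content (i + 1) w) (content (i + 2) w)) +
      offCoeff (content i w) (content (i + 1) w) * φ (swapStep i w) -
      offCoeff (content (i + 1) w) (content (i + 2) w) * φ (swapStep (i + 1) w)) * diag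

end SeminormalOp

section Seminormal

variable {i m N : ℕ} {w : ℕ → ℕ}

/-- The space of functions on the paths of length `N`, the direct sum of the irreducible
representations of the symmetric group of degree `N`. -/
abbrev PathSpace (N : ℕ) : Type := paths N → ℂ

/-- Extension by zero from the paths of length `N` to all sequences. -/
noncomputable def extendPath (N : ℕ) : PathSpace N →ₗ[ℂ] ((ℕ → ℕ) → ℂ) :=
  Function.ExtendByZero.linearMap ℂ fun w : paths N => (w : ℕ → ℕ)

theorem extendPath_coe (φ : PathSpace N) (w : paths N) : extendPath N φ w = φ w :=
  Subtype.val_injective.extend_apply φ 0 w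

theorem extendPath_of_notMem (φ : PathSpace N) (hw : w ∉ paths N) : extendPath N φ w = 0 :=
  Function.extend_apply' φ _ w fun ⟨v, hv⟩ => hw (hv ▸ v.2)

/-- The action of the transposition `(i, i + 1)` in Young's seminormal form, on functions on the
paths of length `N`. -/
noncomputable def seminormalGen (N i : ℕ) : Module.End ℂ (PathSpace N) :=
  LinearMap.funLeft ℂ ℂ (fun w : paths N => (w : ℕ → ℕ)) ∘ₗ seminormalOp i ∘ₗ extendPath N

theorem seminormalGen_apply (φ : PathSpace N) (w : paths N) :
    seminormalGen N i φ w = seminormalOp i (extendPath N φ) w := rfl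

theorem swapStep_notMem_paths (hw : w ∉ paths N) (hi : i + 1 < N)
    (h : offCoeff (content i w) (content (i + 1) w) ≠ 0) : swapStep i w ∉ paths N := by
  have hne := apply_ne_of_offCoeff_ne_zero h
  refine fun hs => hw ?_
  rw [← swapStep_swapStep i w]
  refine swapStep_mem_paths hs hi ?_
  rwa [content_swapStep_self hne, content_swapStep_succ hne, Ne, ← offCoeff_eq_zero_comm]

theorem extendPath_seminormalGen (hi : i + 1 < N) (φ : PathSpace N) :
    extendPath N (seminormalGen N i φ) = seminormalOp i (extendPath N φ) := by
  ext w
  by_cases hw : w ∈ paths N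
  · exact extendPath_coe _ ⟨w, hw⟩
  · rw [extendPath_of_notMem _ hw, seminormalOp_apply, extendPath_of_notMem _ hw, mul_zero,
      zero_add, zero_eq_mul]
    exact or_iff_not_imp_left.2 fun h => extendPath_of_notMem _ (swapStep_notMem_paths hw hi h)

theorem isCoxeterTypeA_seminormalGen (N : ℕ) : IsCoxeterTypeA N (seminormalGen N) where
  mul_self i hi := by
    ext1 φ
    ext1 w
    rw [Module.End.mul_apply, seminormalGen_apply, extendPath_seminormalGen hi,
      seminormalOp_seminormalOp, extendPath_coe, Module.End.one_apply]
  braid i hi := by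
    ext1 φ
    ext1 w
    simp only [Module.End.mul_apply]
    rw [seminormalGen_apply, seminormalGen_apply, extendPath_seminormalGen hi,
      extendPath_seminormalGen (by omega), extendPath_seminormalGen (by omega),
      extendPath_seminormalGen hi,
      seminormalOp_braid _ (content_ne_succ w.2 (by omega)) (content_ne_succ w.2 hi)
        (content_ne_add_two w.2 hi)]
  comm i j hij hj := by
    ext1 φ
    ext1 w
    rw [Module.End.mul_apply, Module.End.mul_apply, seminormalGen_apply, seminormalGen_apply,
      extendPath_seminormalGen hj, extendPath_seminormalGen (by omega), seminormalOp_comm hij]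

/-- Young's seminormal form, on functions on the paths of length `N`. -/
noncomputable def seminormal (N : ℕ) : Perm (Fin N) →* Module.End ℂ (PathSpace N) :=
  (isCoxeterTypeA_seminormalGen N).exists_monoidHom.choose

theorem seminormal_swap (hi : i + 1 < N) :
    seminormal N (swap ⟨i, by omega⟩ ⟨i + 1, hi⟩) = seminormalGen N i :=
  (isCoxeterTypeA_seminormalGen N).exists_monoidHom.choose_spec i hi

/-- Multiplication by a function of the path. -/
def mulPath (N : ℕ) : ((ℕ → ℕ) → ℂ) →ₐ[ℂ] Module.End ℂ (PathSpace N) :=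
  (Algebra.lmul ℂ (PathSpace N)).comp
    (AlgHom.pi fun w : paths N => Pi.evalAlgHom ℂ _ (w : ℕ → ℕ))

theorem mulPath_apply (g : (ℕ → ℕ) → ℂ) (φ : PathSpace N) (w : paths N) :
    mulPath N g φ w = g w * φ w := rfl

theorem extendPath_mulPath (g : (ℕ → ℕ) → ℂ) (φ : PathSpace N) (w : ℕ → ℕ) :
    extendPath N (mulPath N g φ) w = g w * extendPath N φ w := by
  by_cases hw : w ∈ paths N
  · rw [extendPath_coe _ ⟨w, hw⟩, extendPath_coe _ ⟨w, hw⟩, mulPath_apply]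
  · rw [extendPath_of_notMem _ hw, extendPath_of_notMem _ hw, mul_zero]

theorem mulPath_content_succ (hi : i + 1 < N) :
    mulPath N (fun w => content (i + 1) w) =
      seminormalGen N i * mulPath N (fun w => content i w) * seminormalGen N i +
        seminormalGen N i := by
  ext1 φ
  ext1 w
  rw [mulPath_apply, ← extendPath_coe φ w, content_succ_mul _ (content_ne_succ w.2 hi),
    ← extendPath_seminormalGen hi, extendPath_coe, ← funext (extendPath_mulPath _ _)]
  rfl

theorem Iio_fin_succ (hm : m + 1 < N) :
    Iio (⟨m + 1, hm⟩ : Fin N) = insert ⟨m, by omega⟩ (Iio ⟨m, by omega⟩) := by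
  ext j
  simp only [mem_Iio, mem_insert, Fin.lt_def, Fin.ext_iff]
  omega

theorem sum_seminormal_swap (hm : m < N) :
    ∑ j ∈ Iio (⟨m, hm⟩ : Fin N), seminormal N (swap j ⟨m, hm⟩) =
      mulPath N fun w => content m w := by
  induction m with
  | zero =>
    have no_box : mulPath N (fun w => (content 0 w : ℂ)) = 0 := by
      ext1 φ
      ext1 w
      have first_row : (w : ℕ → ℕ) 0 = 0 := Nat.le_zero.1 (path_apply_le w.2 hm)
      simp [mulPath_apply, content, stepBox, uCoord, shapeAt_zero, first_row]
    rw [no_box]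
    exact sum_eq_zero fun j hj => absurd (Fin.lt_def.1 (mem_Iio.1 hj)) (Nat.not_lt_zero _)
  | succ m ih =>
    have conj (j : Fin N) (hj : j ∈ Iio (⟨m, by omega⟩ : Fin N)) :
        seminormal N (swap ⟨m, by omega⟩ ⟨m + 1, hm⟩) * seminormal N (swap j ⟨m, by omega⟩) *
          seminormal N (swap ⟨m, by omega⟩ ⟨m + 1, hm⟩) = seminormal N (swap j ⟨m + 1, hm⟩) := by
      have hjm : (j : ℕ) < m := Fin.lt_def.1 (mem_Iio.1 hj)
      rw [← map_mul, ← map_mul, swap_mul_swap_mul_swap (Fin.ne_of_lt hjm)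
        (Fin.ne_of_lt (Nat.lt_succ_of_lt hjm)), swap_comm]
    rw [mulPath_content_succ hm, ← ih (by omega), ← seminormal_swap hm, Iio_fin_succ,
      sum_insert (by simp), add_comm, mul_sum, sum_mul, sum_congr rfl conj]

end Seminormal

/-! ### Class functions annihilated by Jucys–Murphy sums -/

section ClassFunction

variable {α M : Type*} {π σ : Perm α} {p r x : α}

theorem mem_of_sameCycle [Finite α] {s : Set α} (hs : Set.MapsTo σ s s) (hp : p ∈ s)
    (hx : σ.SameCycle p x) : x ∈ s := by
  obtain ⟨n, rfl⟩ := hx.exists_nat_pow_eq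
  exact hs.perm_pow n hp

variable [DecidableEq α]

theorem mul_swap_inv_apply_self (σ : Perm α) (p : α) : (σ * swap (σ⁻¹ p) p) p = p := by
  simp

theorem mul_zpow_apply_conj (h : π p = p) (r : α) (n : ℤ) :
    π ^ n * (π * swap r p) * (π ^ n)⁻¹ = π * swap ((π ^ n) r) p := by
  have fixed : (π ^ n) p = p := Perm.zpow_apply_eq_self_of_apply_eq_self h n
  rw [← mul_assoc, ← ((Commute.refl π).zpow_right n).eq, mul_assoc π, mul_swap_eq_swap_mul, fixed,
    mul_assoc, mul_assoc, mul_inv_cancel, mul_one]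

/-- Removing `p` from its cycle shortens this cycle, and multiplying by `swap j p` with `j` outside
the shortened cycle leaves it unchanged. -/
theorem sameCycle_of_sameCycle_mul_swap [Finite α] (hp : σ p ≠ p) {j : α}
    (hj : ¬ (σ * swap (σ⁻¹ p) p).SameCycle (σ⁻¹ p) j)
    (hx : (σ * swap (σ⁻¹ p) p * swap j p).SameCycle (σ⁻¹ p) x) : σ.SameCycle p x ∧ x ≠ p := by
  set r := σ⁻¹ p with hr
  set π := σ * swap r p with hπ
  have hrp : r ≠ p := fun h => hp (by rw [← Perm.eq_inv_iff_eq, ← hr, h])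
  have short : Set.MapsTo π {y | σ.SameCycle p y ∧ y ≠ p} {y | σ.SameCycle p y ∧ y ≠ p} := by
    rintro y ⟨hy, hyp⟩
    rw [hπ, Perm.mul_apply]
    by_cases hyr : y = r
    · rw [hyr, swap_apply_left]
      exact ⟨Perm.sameCycle_apply_right.2 (Perm.SameCycle.refl σ p), hp⟩
    · rw [swap_apply_of_ne_of_ne hyr hyp]
      exact ⟨Perm.sameCycle_apply_right.2 hy, fun h => hyr (Perm.eq_inv_iff_eq.2 h)⟩
  have r_mem : r ∈ {y | σ.SameCycle p y ∧ y ≠ p} := ⟨Perm.SameCycle.symm ⟨1, by simp [r]⟩, hrp⟩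
  have mem_short {y : α} (hy : π.SameCycle r y) : σ.SameCycle p y ∧ y ≠ p :=
    (mem_of_sameCycle short r_mem hy :)
  have unchanged : Set.MapsTo (π * swap j p) {y | π.SameCycle r y} {y | π.SameCycle r y} := by
    intro y (hy : π.SameCycle r y)
    rw [Perm.mul_apply, swap_apply_of_ne_of_ne (by rintro rfl; exact hj hy) (mem_short hy).2]
    exact Perm.sameCycle_apply_right.2 hy
  have r_mem' : r ∈ {y | π.SameCycle r y} := Perm.SameCycle.refl π r
  exact mem_short (mem_of_sameCycle unchanged r_mem' hx :)

/-- The induction is on the length of the cycle of a point `p` moved by `σ`: let `π` be `σ` with `p`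
removed from this cycle. If the cycle is a transposition `(r, p)`, compare the sums over the support
of `π` with and without `r`; otherwise, in the sum over the support of `π`, the terms with `j` in
the shortened cycle are conjugate to `σ`, and the other ones have a shorter nontrivial cycle. -/
theorem eq_zero_of_sum_mul_swap_eq_zero [Finite α] [AddCommMonoid M] [IsAddTorsionFree M]
    {χ : Perm α → M} (conj : ∀ σ τ, χ (τ * σ * τ⁻¹) = χ σ)
    (sum_eq_zero : ∀ (S : Finset α) (p : α), p ∉ S → ∀ π : Perm α, (∀ x ∉ S, π x = x) →
      ∑ j ∈ S, χ (π * swap j p) = 0) (hp : σ p ≠ p) : χ σ = 0 := by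
  classical
  cases nonempty_fintype α
  induction hL : {x | σ.SameCycle p x}.ncard using Nat.strong_induction_on generalizing σ p with
  | _ L ih =>
  subst hL
  set r := σ⁻¹ p with hr
  set π := σ * swap r p
  have hσ : π * swap r p = σ := mul_swap_mul_self r p σ
  have hπp : π p = p := mul_swap_inv_apply_self σ p
  have sum_support := sum_eq_zero π.support p (by simpa using hπp) π fun x => Perm.notMem_support.1
  by_cases hπr : π r = r
  · have hrp : r ≠ p := fun h => hp (by rw [← Perm.eq_inv_iff_eq, ← hr, h])
    have sum_insert_r := sum_eq_zero (insert r π.support) p (by simp [hrp.symm, hπp]) π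
      fun x hx => Perm.notMem_support.1 fun h => hx (mem_insert_of_mem h)
    rwa [sum_insert (by simpa using hπr), sum_support, add_zero, hσ] at sum_insert_r
  · have term (j : α) (hj : j ∈ π.support) :
        χ (π * swap j p) = if π.SameCycle r j then χ σ else 0 := by
      split_ifs with hrj
      · obtain ⟨n, rfl⟩ := hrj
        rw [← mul_zpow_apply_conj hπp, conj, hσ]
      · have moved : (π * swap j p) r ≠ r := by
          rwa [Perm.mul_apply, swap_apply_of_ne_of_ne]
          · rintro rfl
            exact hrj (Perm.SameCycle.refl π r)
          · rintro h
            exact hπr (h ▸ hπp)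
        refine ih _ (Set.ncard_lt_ncard ?_) moved rfl
        refine ⟨fun x hx => (sameCycle_of_sameCycle_mul_swap hp hrj hx).1, fun h => ?_⟩
        exact (sameCycle_of_sameCycle_mul_swap hp hrj (h (Perm.SameCycle.refl σ p))).2 rfl
    rw [sum_congr rfl term, ← sum_filter, sum_const, smul_eq_zero, card_eq_zero] at sum_support
    refine sum_support.resolve_left (Nonempty.ne_empty ⟨r, ?_⟩)
    simpa [Perm.SameCycle.refl] using hπr

end ClassFunction

/-! ### The trace weighted by dimensions -/

section DimTrace

variable {N m i : ℕ}

theorem commute_mulPath_seminormalGen {g : (ℕ → ℕ) → ℂ} (hg : ∀ w, g (swapStep i w) = g w) :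
    Commute (mulPath N g) (seminormalGen N i) := by
  ext1 φ
  ext1 w
  simp only [Module.End.mul_apply, mulPath_apply, seminormalGen_apply, seminormalOp_apply,
    extendPath_mulPath, hg]
  ring

/-- Multiplication by the dimension of the final shape. -/
noncomputable def dimOp (N : ℕ) : Module.End ℂ (PathSpace N) :=
  mulPath N fun w => numPaths N (shapeAt N w)

theorem commute_dimOp (N : ℕ) (σ : Perm (Fin N)) : Commute (dimOp N) (seminormal N σ) := by
  induction σ using perm_fin_induction with
  | one => exact map_one (seminormal N) ▸ Commute.one_right _
  | mul i hi σ ih =>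
    rw [map_mul, seminormal_swap]
    exact (commute_mulPath_seminormalGen fun w => by rw [shapeAt_swapStep_of_gt hi]).mul_right ih

/-- The trace in which the block of each final shape `γ` is weighted by its dimension `f ^ γ`, as
in the regular representation. -/
noncomputable def dimTrace (N : ℕ) : Module.End ℂ (PathSpace N) →ₗ[ℂ] ℂ :=
  LinearMap.trace ℂ _ ∘ₗ LinearMap.mulLeft ℂ (dimOp N)

theorem dimTrace_apply (A : Module.End ℂ (PathSpace N)) :
    dimTrace N A = LinearMap.trace ℂ _ (dimOp N * A) := rfl

theorem dimTrace_conj (σ τ : Perm (Fin N)) :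
    dimTrace N (seminormal N (τ * σ * τ⁻¹)) = dimTrace N (seminormal N σ) := by
  rw [dimTrace_apply, map_mul (seminormal N), map_mul (seminormal N), mul_assoc, ← mul_assoc,
    (commute_dimOp N τ).eq, mul_assoc, LinearMap.trace_mul_comm, mul_assoc, mul_assoc,
    ← map_mul (seminormal N), inv_mul_cancel, map_one, mul_one, dimTrace_apply]

open Classical in
theorem trace_mul_mulPath (A : Module.End ℂ (PathSpace N)) (g : (ℕ → ℕ) → ℂ) :
    LinearMap.trace ℂ _ (A * mulPath N g) = ∑ w : paths N, g w * A (Pi.single w 1) w := by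
  rw [LinearMap.trace_mul_comm, LinearMap.trace_eq_matrix_trace ℂ (Pi.basisFun ℂ (paths N)),
    Matrix.trace]
  refine sum_congr rfl fun w _ => ?_
  rw [Matrix.diag_apply, LinearMap.toMatrix_apply, Pi.basisFun_repr, Pi.basisFun_apply]
  rfl

end DimTrace

/-! ### Operators involving only the first steps of a path -/

section ActsOnFirst

variable {N m i : ℕ}

/-- The operator involves only the first `m` terms of the sequences, the others being
parameters. -/
def ActsOnFirst (m : ℕ) (T : Module.End ℂ ((ℕ → ℕ) → ℂ)) : Prop :=
  ∀ φ u z, T φ ((Set.Iio m).piecewise u z) = T (fun v => φ ((Set.Iio m).piecewise v z)) u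

theorem ActsOnFirst.mul {T U : Module.End ℂ ((ℕ → ℕ) → ℂ)} (hT : ActsOnFirst m T)
    (hU : ActsOnFirst m U) : ActsOnFirst m (T * U) := fun φ u z => by
  simp only [Module.End.mul_apply, hT (U φ), hU φ]

theorem ActsOnFirst.apply_update {T : Module.End ℂ ((ℕ → ℕ) → ℂ)} (hT : ActsOnFirst m T)
    {φ : (ℕ → ℕ) → ℂ} (hφ : ∀ v z, φ ((Set.Iio m).piecewise v z) = φ v) {k : ℕ} (hk : m ≤ k)
    (u : ℕ → ℕ) (x : ℕ) : T φ (Function.update u k x) = T φ u := by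
  have split : Function.update u k x = (Set.Iio m).piecewise u (Function.update u k x) := by
    ext j
    by_cases hj : j ∈ Set.Iio m
    · rw [Set.piecewise_eq_of_mem _ _ _ hj, Function.update_of_ne (hj.trans_le hk).ne]
    · rw [Set.piecewise_eq_of_notMem _ _ _ hj]
  rw [split, hT, funext fun v => hφ v _]

theorem swapStep_piecewise (hi : i + 1 < m) (u z : ℕ → ℕ) :
    swapStep i ((Set.Iio m).piecewise u z) = (Set.Iio m).piecewise (swapStep i u) z := by
  ext j
  by_cases hj : j ∈ Set.Iio m
  · have hj' : swap i (i + 1) j ∈ Set.Iio m := by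
      rw [Set.mem_Iio] at hj ⊢
      rw [swap_apply_def]
      split_ifs <;> lia
    rw [Set.piecewise_eq_of_mem _ _ _ hj]
    exact Set.piecewise_eq_of_mem _ _ _ hj'
  · have hmj : m ≤ j := not_lt.1 hj
    rw [Set.piecewise_eq_of_notMem _ _ _ hj, swapStep_of_ne (by lia) (by lia),
      Set.piecewise_eq_of_notMem _ _ _ hj]

theorem content_piecewise (hi : i < m) (u z : ℕ → ℕ) :
    content i ((Set.Iio m).piecewise u z) = content i u :=
  content_congr fun _ hj => Set.piecewise_eq_of_mem _ _ _ (hj.trans_lt hi)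

theorem actsOnFirst_seminormalOp (hi : i + 1 < m) : ActsOnFirst m (seminormalOp i) :=
  fun φ u z => by
    simp only [seminormalOp_apply, swapStep_piecewise hi, content_piecewise hi,
      content_piecewise (Nat.lt_of_succ_lt hi)]

theorem perm_fin_induction_of_fixed (hm : m ≤ N) {p : Perm (Fin N) → Prop} (one : p 1)
    (mul : ∀ i (hi : i + 1 < m) σ, p σ → p (swap ⟨i, by lia⟩ ⟨i + 1, by lia⟩ * σ))
    {π : Perm (Fin N)} (hπ : ∀ x : Fin N, m ≤ x → π x = x) : p π := by
  have extend (σ : Perm (Fin m)) : p (σ.extendDomain (Fin.castLEquiv hm)) := by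
    induction σ using perm_fin_induction with
    | one => rwa [Perm.extendDomain_one]
    | mul i hi σ ih =>
      rw [← Perm.extendDomain_mul, extendDomain_swap]
      exact mul i hi _ ih
  have stable (x : Fin N) : (π x : ℕ) < m ↔ (x : ℕ) < m := by
    constructor
    · contrapose!
      exact fun hx => (hπ x hx).symm ▸ hx
    · contrapose!
      exact fun hx => π.injective (hπ (π x) hx) ▸ hx
  have restrict : ((Fin.castLEquiv hm).symm.permCongr (π.subtypePerm stable)).extendDomain
      (Fin.castLEquiv hm) = π := by
    ext x
    by_cases hx : (x : ℕ) < m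
    · rw [Perm.extendDomain_apply_subtype _ (Fin.castLEquiv hm) hx]
      simp [Equiv.permCongr_apply]
    · rw [Perm.extendDomain_apply_not_subtype _ (Fin.castLEquiv hm) hx, hπ x (not_lt.1 hx)]
  exact restrict ▸ extend _

theorem exists_actsOnFirst (hm : m ≤ N) {π : Perm (Fin N)} (hπ : ∀ x : Fin N, m ≤ x → π x = x) :
    ∃ T, ActsOnFirst m T ∧ ∀ φ, extendPath N (seminormal N π φ) = T (extendPath N φ) := by
  refine perm_fin_induction_of_fixed hm (p := fun π => ∃ T, ActsOnFirst m T ∧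
    ∀ φ, extendPath N (seminormal N π φ) = T (extendPath N φ)) ?_ ?_ hπ
  · exact ⟨1, fun _ _ _ => rfl, fun φ => by simp only [map_one, Module.End.one_apply]⟩
  · rintro i hi σ ⟨T, hT, extend⟩
    refine ⟨seminormalOp i * T, (actsOnFirst_seminormalOp hi).mul hT, fun φ => ?_⟩
    rw [map_mul, seminormal_swap, Module.End.mul_apply, extendPath_seminormalGen (by lia), extend,
      Module.End.mul_apply]

/-- The indicator function of the sequences with the same first `m` terms as `u`. -/
noncomputable def cylinder (m : ℕ) (u : ℕ → ℕ) : (ℕ → ℕ) → ℂ :=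
  fun v => if ∀ i < m, v i = u i then 1 else 0

theorem cylinder_piecewise (m : ℕ) (u v z : ℕ → ℕ) :
    cylinder m u ((Set.Iio m).piecewise v z) = cylinder m u v := by
  have agree (i) (hi : i < m) : (Set.Iio m).piecewise v z i = v i :=
    Set.piecewise_eq_of_mem _ _ _ hi
  simp +contextual only [cylinder, agree]

theorem cylinder_update {k : ℕ} (hk : m ≤ k) (u : ℕ → ℕ) (x : ℕ) :
    cylinder m (Function.update u k x) = cylinder m u := by
  have agree (i) (hi : i < m) : Function.update u k x i = u i :=
    Function.update_of_ne (hi.trans_le hk).ne _ _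
  ext v
  simp +contextual only [cylinder, agree]

open Classical in
theorem extendPath_single (w : paths N) (v : ℕ → ℕ) :
    extendPath N (Pi.single w 1) v = if v = w then 1 else 0 := by
  by_cases hv : v ∈ paths N
  · rw [extendPath_coe _ ⟨v, hv⟩, Pi.single_apply]
    exact if_congr Subtype.ext_iff rfl rfl
  · rw [extendPath_of_notMem _ hv, if_neg (ne_of_mem_of_not_mem w.2 hv).symm]

open Classical in
theorem extendPath_single_piecewise (w : paths N) (v : ℕ → ℕ) :
    extendPath N (Pi.single w 1) ((Set.Iio m).piecewise v w) = cylinder m w v := by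
  have glue_eq : (Set.Iio m).piecewise v w = w ↔ ∀ i < m, v i = (w : ℕ → ℕ) i := by
    rw [funext_iff]
    refine forall_congr' fun i => ?_
    by_cases hi : i < m <;> simp [Set.piecewise, hi]
  rw [extendPath_single, cylinder]
  exact if_congr glue_eq rfl rfl

open Classical in
theorem dimTrace_mul_content (hm : m < N) {π : Perm (Fin N)}
    (hπ : ∀ x : Fin N, m ≤ x → π x = x) :
    dimTrace N (seminormal N π * mulPath N fun w => content m w) = 0 := by
  obtain ⟨T, hT, extend⟩ := exists_actsOnFirst hm.le hπ
  have diagonal (w : paths N) : seminormal N π (Pi.single w 1) w = T (cylinder m w) w := by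
    have glue_self := hT (extendPath N (Pi.single w 1)) w w
    simp only [Set.piecewise_same, extendPath_single_piecewise] at glue_self
    rw [← extendPath_coe (seminormal N π _) w, extend, glue_self]
  have update (w k x) (hk : m ≤ k) : T (cylinder m (Function.update w k x))
      (Function.update w k x) = T (cylinder m w) w := by
    rw [cylinder_update hk, hT.apply_update (cylinder_piecewise m w) hk]
  have weighted_sum : plancherelSum N (fun w => content m w * T (cylinder m w) w) = 0 := by
    refine plancherelSum_eq_zero_of_le (Nat.succ_le_of_lt hm) (fun w k x hk => ?_)
      (plancherelSum_content_mul fun w x => update w m x le_rfl)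
    rw [update w k x (Nat.le_of_succ_le hk),
      content_congr fun j hj => Function.update_of_ne (by lia) _ _]
  rw [dimTrace_apply, ← mul_assoc, trace_mul_mulPath, ← weighted_sum, plancherelSum,
    ← sum_coe_sort (paths N)]
  refine sum_congr rfl fun w _ => ?_
  rw [Module.End.mul_apply, dimOp, mulPath_apply, diagonal, mul_left_comm]

end ActsOnFirst

section TraceFormula

variable {N : ℕ}

theorem exists_perm_lt_iff_mem {S : Finset (Fin N)} {p : Fin N} (hp : p ∉ S) :
    ∃ τ : Perm (Fin N), ∀ j, τ j < τ p ↔ j ∈ S := by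
  let rank (j : Fin N) : ℕ := if j ∈ S then 0 else if j = p then 1 else 2
  have lt_of_rank_lt {i j} (h : rank i < rank j) :
      (Tuple.sort rank)⁻¹ i < (Tuple.sort rank)⁻¹ j :=
    (Tuple.monotone_sort rank).reflect_lt (by simpa using h)
  refine ⟨(Tuple.sort rank)⁻¹, fun j => ⟨not_imp_not.1 fun hj h => ?_,
    fun hj => lt_of_rank_lt (by simp [rank, hj, hp])⟩⟩
  rcases eq_or_ne j p with rfl | hjp
  · exact lt_irrefl _ h
  · exact lt_asymm h (lt_of_rank_lt (by simp [rank, hj, hjp, hp]))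

theorem sum_dimTrace_mul_swap {S : Finset (Fin N)} {p : Fin N} (hp : p ∉ S) {π : Perm (Fin N)}
    (hπ : ∀ x ∉ S, π x = x) : ∑ j ∈ S, dimTrace N (seminormal N (π * swap j p)) = 0 := by
  obtain ⟨τ, hτ⟩ := exists_perm_lt_iff_mem hp
  have fixed (y : Fin N) (hy : (τ p : ℕ) ≤ y) : (τ * π * τ⁻¹) y = y := by
    have hS : τ⁻¹ y ∉ S := by
      rw [← hτ, ← Perm.mul_apply, mul_inv_cancel]
      exact not_lt.2 hy
    rw [Perm.mul_apply, Perm.mul_apply, hπ _ hS, ← Perm.mul_apply, mul_inv_cancel, Perm.one_apply]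
  rw [← dimTrace_mul_content (τ p).2 fixed, ← sum_seminormal_swap (τ p).2, mul_sum, map_sum]
  refine sum_equiv τ (fun j => by rw [mem_Iio, hτ]) fun j _ => ?_
  rw [← map_mul, ← dimTrace_conj _ τ, Fin.eta, swap_apply_apply]
  simp only [mul_assoc, inv_mul_cancel_left]

theorem dimTrace_seminormal (σ : Perm (Fin N)) :
    dimTrace N (seminormal N σ) = if σ = 1 then (N.factorial : ℂ) else 0 := by
  split_ifs with h
  · rw [h, map_one, dimTrace_apply, mul_one, ← one_mul (dimOp N), dimOp, trace_mul_mulPath,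
      ← plancherelSum_one, plancherelSum, ← sum_coe_sort (paths N)]
    simp only [Module.End.one_apply, Pi.single_eq_same]
  · obtain ⟨p, hp⟩ := not_forall.1 (mt Equiv.ext h)
    exact eq_zero_of_sum_mul_swap_eq_zero (χ := fun σ => dimTrace N (seminormal N σ)) dimTrace_conj
      (fun _ _ hp _ => sum_dimTrace_mul_swap hp) hp

end TraceFormula

/-! ### Row insertion -/

section RowInsert

variable {α : Type*} [LinearOrder α] {x x' a y y' : α} {r r' : List α}

theorem rowInsert_cons_of_lt (h : x < a) (r : List α) : rowInsert x (a :: r) = (x :: r, some a) :=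
  if_pos h

theorem rowInsert_cons_of_le (h : a ≤ x) (r : List α) :
    rowInsert x (a :: r) = (a :: (rowInsert x r).1, (rowInsert x r).2) :=
  if_neg h.not_gt

theorem rowInsert_fst_of_none (h : (rowInsert x r).2 = none) : (rowInsert x r).1 = r ++ [x] := by
  induction r with
  | nil => rfl
  | cons a r ih =>
    rcases lt_or_ge x a with hx | hx
    · simp [rowInsert_cons_of_lt hx] at h
    · rw [rowInsert_cons_of_le hx] at h ⊢
      rw [ih h, List.cons_append]

theorem rowInsert_perm (x : α) (r : List α) :
    ((rowInsert x r).1 ++ (rowInsert x r).2.toList).Perm (x :: r) := by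
  induction r with
  | nil => simp [rowInsert]
  | cons a r ih =>
    rcases lt_or_ge x a with hx | hx
    · rw [rowInsert_cons_of_lt hx]
      exact (List.perm_append_singleton a r).cons x
    · rw [rowInsert_cons_of_le hx]
      exact (ih.cons a).trans (.swap x a r)

theorem mem_rowInsert_self (x : α) (r : List α) : x ∈ (rowInsert x r).1 := by
  induction r with
  | nil => simp [rowInsert]
  | cons a r ih =>
    rcases lt_or_ge x a with hx | hx
    · simp [rowInsert_cons_of_lt hx]
    · simp [rowInsert_cons_of_le hx, ih]

theorem mem_of_mem_rowInsert (h : y ∈ (rowInsert x r).1) : y = x ∨ y ∈ r :=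
  List.mem_cons.1 ((rowInsert_perm x r).subset (List.mem_append_left _ h))

theorem mem_of_bumped (h : (rowInsert x r).2 = some y) : y ∈ r := by
  have hy : y ∈ x :: r := (rowInsert_perm x r).subset (by simp [h])
  exact (List.mem_cons.1 hy).resolve_left (rowInsert_bumped_gt x r h).ne'

theorem pairwise_rowInsert (h : r.Pairwise (· ≤ ·)) : (rowInsert x r).1.Pairwise (· ≤ ·) := by
  induction r with
  | nil => simp [rowInsert]
  | cons a r ih =>
    rw [List.pairwise_cons] at h
    rcases lt_or_ge x a with hx | hx
    · rw [rowInsert_cons_of_lt hx, List.pairwise_cons]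
      exact ⟨fun b hb => hx.le.trans (h.1 b hb), h.2⟩
    · rw [rowInsert_cons_of_le hx, List.pairwise_cons]
      refine ⟨fun b hb => ?_, ih h.2⟩
      rcases mem_of_mem_rowInsert hb with rfl | hb
      · exact hx
      · exact h.1 b hb

theorem rowInsert_injective (hr : r.Pairwise (· ≤ ·)) (hr' : r'.Pairwise (· ≤ ·))
    (fst_eq : (rowInsert x r).1 = (rowInsert x' r').1) (hy : (rowInsert x r).2 = some y)
    (hy' : (rowInsert x' r').2 = some y) : r = r' ∧ x = x' := by
  induction r generalizing r' with
  | nil => simp [rowInsert] at hy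
  | cons a r ih =>
    cases r' with
    | nil => simp [rowInsert] at hy'
    | cons b r' =>
      have hxy := rowInsert_bumped_gt x _ hy
      have hxy' := rowInsert_bumped_gt x' _ hy'
      rw [List.pairwise_cons] at hr hr'
      rcases lt_or_ge x a with hx | hx <;> rcases lt_or_ge x' b with hx' | hx' <;>
        simp only [rowInsert_cons_of_lt, rowInsert_cons_of_le, hx, hx', Option.some.injEq,
          List.cons.injEq] at fst_eq hy hy'
      · exact ⟨by rw [hy, hy', fst_eq.2], fst_eq.1⟩
      · have := hr.1 x' (fst_eq.2 ▸ mem_rowInsert_self x' r')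
        exact absurd (hy ▸ hxy') this.not_gt
      · have := hr'.1 x (fst_eq.2 ▸ mem_rowInsert_self x r)
        exact absurd (hy' ▸ hxy) this.not_gt
      · obtain ⟨rfl, rfl⟩ := ih hr.2 hr'.2 fst_eq.2 hy hy'
        exact ⟨by rw [fst_eq.1], rfl⟩

theorem rowInsert_snd_eq_none_of_le (hx : x ≤ x') (h : (rowInsert x r).2 = none) :
    (rowInsert x' (rowInsert x r).1).2 = none := by
  induction r with
  | nil => simp [rowInsert, hx.not_gt]
  | cons a r ih =>
    rcases lt_or_ge x a with ha | ha
    · simp [rowInsert_cons_of_lt ha] at h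
    · rw [rowInsert_cons_of_le ha] at h ⊢
      rw [rowInsert_cons_of_le (ha.trans hx)]
      exact ih h

theorem bumped_le_bumped (hr : r.Pairwise (· ≤ ·)) (hx : x ≤ x') (hy : (rowInsert x r).2 = some y)
    (hy' : (rowInsert x' (rowInsert x r).1).2 = some y') : y ≤ y' := by
  induction r with
  | nil => simp [rowInsert] at hy
  | cons a r ih =>
    rw [List.pairwise_cons] at hr
    rcases lt_or_ge x a with ha | ha
    · simp only [rowInsert_cons_of_lt ha, rowInsert_cons_of_le hx, Option.some.injEq] at hy hy'
      exact hy ▸ hr.1 _ (mem_of_bumped hy')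
    · simp only [rowInsert_cons_of_le ha, rowInsert_cons_of_le (ha.trans hx)] at hy hy'
      exact ih hr.2 hy hy'

theorem rowInsert_map {β : Type*} [LinearOrder β] {f : α → β} (hf : StrictMono f) (x : α)
    (r : List α) :
    rowInsert (f x) (r.map f) = ((rowInsert x r).1.map f, (rowInsert x r).2.map f) := by
  induction r with
  | nil => rfl
  | cons a r ih =>
    rcases lt_or_ge x a with hx | hx
    · simp [rowInsert_cons_of_lt, hx, hf hx]
    · simp [rowInsert_cons_of_le, hx, hf.monotone hx, ih]

end RowInsert

/-! ### Insertion into a tableau -/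

section TableauInsert

variable {α : Type*} [LinearOrder α] {T T' : List (List α)} {x x' y : α} {r : List α}

/-- The length of a row of a tableau, `0` below the last row. -/
def rowLen (T : List (List α)) (j : ℕ) : ℕ := (T.getD j []).length

/-- The row in which the insertion of `x` into a tableau creates a new box. -/
def insertRow : List (List α) → α → ℕ
  | [], _ => 0
  | r :: T, x =>
    match (rowInsert x r).2 with
    | none => 0
    | some y => insertRow T y + 1

theorem insertRow_of_none (T : List (List α)) (h : (rowInsert x r).2 = none) :
    insertRow (r :: T) x = 0 := by
  rw [insertRow, h]

theorem insertRow_of_some (T : List (List α)) (h : (rowInsert x r).2 = some y) :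
    insertRow (r :: T) x = insertRow T y + 1 := by
  rw [insertRow, h]

theorem tableauInsert_of_none (T : List (List α)) (h : (rowInsert x r).2 = none) :
    tableauInsert (r :: T) x = (rowInsert x r).1 :: T := by
  rw [tableauInsert, h]

theorem tableauInsert_of_some (T : List (List α)) (h : (rowInsert x r).2 = some y) :
    tableauInsert (r :: T) x = (rowInsert x r).1 :: tableauInsert T y := by
  rw [tableauInsert, h]

theorem tableauInsert_of_insertRow_eq_zero (h : insertRow T x = 0) :
    tableauInsert T x = (T.getD 0 [] ++ [x]) :: T.tail := by
  cases T with
  | nil => rfl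
  | cons r T =>
    cases hy : (rowInsert x r).2 with
    | none => rw [tableauInsert_of_none T hy, rowInsert_fst_of_none hy, List.getD_cons_zero,
        List.tail_cons]
    | some y => simp [insertRow_of_some T hy] at h

theorem exists_of_insertRow_eq_succ {k : ℕ} (h : insertRow T x = k + 1) :
    ∃ r S y, T = r :: S ∧ (rowInsert x r).2 = some y ∧ insertRow S y = k := by
  cases T with
  | nil => simp [insertRow] at h
  | cons r S =>
    cases hy : (rowInsert x r).2 with
    | none => simp [insertRow_of_none S hy] at h
    | some y => exact ⟨r, S, y, rfl, hy, Nat.succ_injective ((insertRow_of_some S hy).symm.trans h)⟩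

/-- The rows of the tableau are weakly increasing and not empty. -/
def SortedRows (T : List (List α)) : Prop := ∀ r ∈ T, r.Pairwise (· ≤ ·) ∧ r ≠ []

theorem sortedRows_cons : SortedRows (r :: T) ↔ (r.Pairwise (· ≤ ·) ∧ r ≠ []) ∧ SortedRows T :=
  List.forall_mem_cons

theorem SortedRows.eq_of_getD_eq (hT : SortedRows T) (hT' : SortedRows T')
    (h : ∀ j, T.getD j [] = T'.getD j []) : T = T' := by
  induction T generalizing T' with
  | nil =>
    cases T' with
    | nil => rfl
    | cons r' S' => exact absurd (h 0).symm (sortedRows_cons.1 hT').1.2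
  | cons r S ih =>
    cases T' with
    | nil => exact absurd (h 0) (sortedRows_cons.1 hT).1.2
    | cons r' S' =>
      have head : r = r' := h 0
      have tail : S = S' :=
        ih (sortedRows_cons.1 hT).2 (sortedRows_cons.1 hT').2 fun j => h (j + 1)
      rw [head, tail]

theorem SortedRows.tableauInsert (hT : SortedRows T) (x : α) :
    SortedRows (tableauInsert T x) := by
  induction T generalizing x with
  | nil => simp [PieriGrowth.tableauInsert, SortedRows]
  | cons r T ih =>
    rw [sortedRows_cons] at hT
    have first_row : (rowInsert x r).1.Pairwise (· ≤ ·) ∧ (rowInsert x r).1 ≠ [] :=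
      ⟨pairwise_rowInsert hT.1.1, List.ne_nil_of_mem (mem_rowInsert_self x r)⟩
    cases hy : (rowInsert x r).2 with
    | none => exact tableauInsert_of_none T hy ▸ sortedRows_cons.2 ⟨first_row, hT.2⟩
    | some y => exact tableauInsert_of_some T hy ▸ sortedRows_cons.2 ⟨first_row, ih hT.2 y⟩

theorem rowLen_tableauInsert (T : List (List α)) (x : α) :
    rowLen (tableauInsert T x) = addBox (rowLen T) (insertRow T x) := by
  induction T generalizing x with
  | nil =>
    ext (_ | j) <;> simp [addBox_apply, tableauInsert, insertRow, rowLen]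
  | cons r T ih =>
    have row_length := rowInsert_length x r
    cases hy : (rowInsert x r).2 with
    | none =>
      rw [tableauInsert_of_none T hy, insertRow_of_none T hy]
      ext (_ | j)
      · simpa [addBox_apply, rowLen, hy] using row_length
      · simp [addBox_apply, rowLen]
    | some y =>
      rw [tableauInsert_of_some T hy, insertRow_of_some T hy]
      ext (_ | j)
      · simpa [addBox_apply, rowLen, hy] using row_length
      · simpa [addBox_apply, rowLen] using congrFun (ih y) j

theorem tableauInsert_injective (hT : SortedRows T) (hT' : SortedRows T')
    (insert_eq : tableauInsert T x = tableauInsert T' x')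
    (row_eq : insertRow T x = insertRow T' x') : T = T' ∧ x = x' := by
  induction hk : insertRow T x generalizing T T' x x' with
  | zero =>
    rw [tableauInsert_of_insertRow_eq_zero hk,
      tableauInsert_of_insertRow_eq_zero (row_eq ▸ hk), List.cons.injEq] at insert_eq
    obtain ⟨head, last⟩ := List.append_inj' insert_eq.1 rfl
    refine ⟨hT.eq_of_getD_eq hT' fun j => ?_, List.singleton_injective last⟩
    cases j with
    | zero => exact head
    | succ j => simpa [List.getD_eq_getElem?_getD] using congrArg (fun S => S.getD j []) insert_eq.2
  | succ k ih =>
    have hk' := row_eq.symm.trans hk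
    obtain ⟨r, S, y, rfl, hy, hk⟩ := exists_of_insertRow_eq_succ hk
    obtain ⟨r', S', y', rfl, hy', hk'⟩ := exists_of_insertRow_eq_succ hk'
    rw [sortedRows_cons] at hT hT'
    rw [tableauInsert_of_some S hy, tableauInsert_of_some S' hy', List.cons.injEq] at insert_eq
    obtain ⟨rfl, rfl⟩ := ih hT.2 hT'.2 insert_eq.2 (hk.trans hk'.symm) hk
    obtain ⟨rfl, rfl⟩ := rowInsert_injective hT.1.1 hT'.1.1 insert_eq.1 hy hy'
    exact ⟨rfl, rfl⟩

theorem insertRow_tableauInsert_le (hT : SortedRows T) (hx : x ≤ x') :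
    insertRow (tableauInsert T x) x' ≤ insertRow T x := by
  induction T generalizing x x' with
  | nil => simp [tableauInsert, insertRow, rowInsert, hx.not_gt]
  | cons r T ih =>
    rw [sortedRows_cons] at hT
    cases hy : (rowInsert x r).2 with
    | none =>
      rw [tableauInsert_of_none T hy, insertRow_of_none T hy,
        insertRow_of_none T (rowInsert_snd_eq_none_of_le hx hy)]
    | some y =>
      rw [tableauInsert_of_some T hy, insertRow_of_some T hy]
      cases hy' : (rowInsert x' (rowInsert x r).1).2 with
      | none =>
        rw [insertRow_of_none _ hy']
        exact Nat.zero_le _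
      | some y' =>
        rw [insertRow_of_some _ hy']
        exact Nat.succ_le_succ (ih hT.2 (bumped_le_bumped hT.1.1 hx hy hy'))

theorem flatten_tableauInsert_perm (T : List (List α)) (x : α) :
    (tableauInsert T x).flatten.Perm (x :: T.flatten) := by
  induction T generalizing x with
  | nil => simp [tableauInsert]
  | cons r T ih =>
    have row_perm := (rowInsert_perm x r).append_right T.flatten
    cases hy : (rowInsert x r).2 with
    | none => simpa [tableauInsert_of_none T hy, hy] using row_perm
    | some y =>
      rw [tableauInsert_of_some T hy, List.flatten_cons]
      exact ((ih y).append_left _).trans (by simpa [hy] using row_perm)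

theorem tableauInsert_map {β : Type*} [LinearOrder β] {f : α → β} (hf : StrictMono f)
    (T : List (List α)) (x : α) :
    tableauInsert (T.map (List.map f)) (f x) = (tableauInsert T x).map (List.map f) := by
  induction T generalizing x with
  | nil => rfl
  | cons r T ih =>
    rw [List.map_cons, tableauInsert, tableauInsert, rowInsert_map hf]
    cases (rowInsert x r).2 with
    | none => simp
    | some y => simp [ih]

end TableauInsert

/-! ### The recording path of Robinson–Schensted insertion -/

section RecordingPath

variable {α : Type*} [LinearOrder α] {l l' : List α} {i m : ℕ}

theorem insertionTableau_append_singleton (l : List α) (x : α) :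
    insertionTableau (l ++ [x]) = tableauInsert (insertionTableau l) x := by
  simp [insertionTableau]

theorem insertionTableau_take_succ (h : i < l.length) :
    insertionTableau (l.take (i + 1)) = tableauInsert (insertionTableau (l.take i)) l[i] := by
  rw [← insertionTableau_append_singleton, List.take_succ_eq_append_getElem h]

theorem sortedRows_insertionTableau (l : List α) : SortedRows (insertionTableau l) := by
  induction l using List.reverseRecOn with
  | nil => simp [insertionTableau, SortedRows]
  | append_singleton l x ih => exact insertionTableau_append_singleton l x ▸ ih.tableauInsert x

theorem flatten_insertionTableau_perm (l : List α) : (insertionTableau l).flatten.Perm l := by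
  induction l using List.reverseRecOn with
  | nil => simp [insertionTableau]
  | append_singleton l x ih =>
    rw [insertionTableau_append_singleton]
    exact (flatten_tableauInsert_perm _ x).trans
      ((ih.cons x).trans (List.perm_append_singleton x l).symm)

theorem dominates_getD {T : List (List α)} (hT : T.IsChain Dominates) (j : ℕ) :
    Dominates (T.getD j []) (T.getD (j + 1) []) := by
  by_cases hj : j + 1 < T.length
  · rw [List.getD_eq_getElem _ _ hj, List.getD_eq_getElem _ _ (Nat.lt_of_succ_lt hj)]
    exact List.isChain_iff_getElem.1 hT j hj
  · rw [List.getD_eq_default T (n := j + 1) _ (not_lt.1 hj), Dominates]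
    trivial

theorem antitone_rowLen_insertionTableau (l : List α) : Antitone (rowLen (insertionTableau l)) :=
  antitone_nat_of_succ_le fun j => (dominates_getD (isChain_insertionTableau l) j).length_le

theorem mem_rskShape {c : ℕ × ℕ} :
    c ∈ rskShape l ↔ c.2 < rowLen (insertionTableau l) c.1 := by
  rw [rskShape, YoungDiagram.mem_ofRowLens, rowLen]
  by_cases hc : c.1 < (insertionTableau l).length <;> simp [List.getD_eq_getElem?_getD, hc]

theorem insertionTableau_map {β : Type*} [LinearOrder β] {f : α → β} (hf : StrictMono f)
    (l : List α) : insertionTableau (l.map f) = (insertionTableau l).map (List.map f) := by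
  induction l using List.reverseRecOn with
  | nil => rfl
  | append_singleton l x ih =>
    rw [List.map_append, List.map_singleton, insertionTableau_append_singleton,
      insertionTableau_append_singleton, ih, tableauInsert_map hf]

theorem rskShape_map {β : Type*} [LinearOrder β] {f : α → β} (hf : StrictMono f) (l : List α) :
    rskShape (l.map f) = rskShape l := by
  simp only [rskShape, insertionTableau_map hf, List.map_map, Function.comp_def, List.length_map]

/-- The Robinson–Schensted recording tableau of a word, as a path: the `i`-th step is the row of
the box created by the `i`-th letter. -/
def recordingPath (l : List α) (i : ℕ) : ℕ :=
  if h : i < l.length then insertRow (insertionTableau (l.take i)) l[i] else 0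

theorem recordingPath_of_lt (h : i < l.length) :
    recordingPath l i = insertRow (insertionTableau (l.take i)) l[i] :=
  dif_pos h

theorem shapeAt_recordingPath (hm : m ≤ l.length) :
    shapeAt m (recordingPath l) = rowLen (insertionTableau (l.take m)) := by
  induction m with
  | zero =>
    ext j
    simp [shapeAt_zero, rowLen, insertionTableau]
  | succ m ih =>
    rw [shapeAt_succ, insertionTableau_take_succ hm, rowLen_tableauInsert,
      ih (Nat.le_of_succ_le hm), recordingPath_of_lt hm]

theorem recordingPath_mem_paths (l : List α) : recordingPath l ∈ paths l.length := by
  refine mem_paths.2 ⟨fun m hm => ?_, fun i hi => dif_neg hi.not_gt⟩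
  rw [shapeAt_recordingPath hm]
  exact antitone_rowLen_insertionTableau _

theorem recordingPath_succ_le (hi : i + 1 < l.length) (h : l[i] ≤ l[i + 1]) :
    recordingPath l (i + 1) ≤ recordingPath l i := by
  rw [recordingPath_of_lt hi, recordingPath_of_lt (Nat.lt_of_succ_lt hi),
    insertionTableau_take_succ (Nat.lt_of_succ_lt hi)]
  exact insertRow_tableauInsert_le (sortedRows_insertionTableau _) h

theorem eq_of_insertionTableau_eq (length_eq : l.length = l'.length)
    (tableau_eq : insertionTableau l = insertionTableau l')
    (path_eq : recordingPath l = recordingPath l') : l = l' := by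
  suffices take_eq : ∀ m ≤ l.length, insertionTableau (l.take m) = insertionTableau (l'.take m) →
      l.take m = l'.take m by
    have full := take_eq l.length le_rfl
    rw [List.take_length, length_eq, List.take_length] at full
    exact full tableau_eq
  intro m hm h
  induction m with
  | zero => rfl
  | succ m ih =>
    have hm' : m < l'.length := length_eq ▸ hm
    have row_eq := congrFun path_eq m
    rw [recordingPath_of_lt hm, recordingPath_of_lt hm'] at row_eq
    rw [insertionTableau_take_succ hm, insertionTableau_take_succ hm'] at h
    obtain ⟨tableau_eq, letter_eq⟩ := tableauInsert_injective (sortedRows_insertionTableau _)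
      (sortedRows_insertionTableau _) h row_eq
    rw [List.take_succ_eq_append_getElem hm, List.take_succ_eq_append_getElem hm', letter_eq,
      ih (Nat.le_of_succ_le hm) tableau_eq]

end RecordingPath

/-! ### Standard tableaux as paths -/

section TableauPath

/-- The index of the row of the tableau `T` containing the entry `a`, and `0` if there is none.
For a standard tableau with entries `0, …, N - 1` this is the path that reads the tableau as a
growing sequence of shapes. -/
def rowOf {α : Type*} [DecidableEq α] (T : List (List α)) (a : α) : ℕ :=
  if a ∈ T.flatten then T.findIdx (fun r => a ∈ r) else 0

theorem getD_nil_mem_or_eq_nil {α : Type*} (T : List (List α)) (j : ℕ) :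
    T.getD j [] ∈ T ∨ T.getD j [] = [] := by
  rcases lt_or_ge j T.length with hj | hj
  · exact .inl (List.getD_eq_getElem _ _ hj ▸ List.getElem_mem hj)
  · exact .inr (List.getD_eq_default _ _ hj)

theorem nodup_getD_nil {α : Type*} {T : List (List α)} (hT : T.flatten.Nodup) (j : ℕ) :
    (T.getD j []).Nodup := by
  rcases getD_nil_mem_or_eq_nil T j with h | h
  · exact (List.nodup_flatten.1 hT).1 _ h
  · rw [h]
    exact List.nodup_nil

theorem mem_flatten_of_mem_getD_nil {α : Type*} {T : List (List α)} {a : α} {j : ℕ}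
    (ha : a ∈ T.getD j []) : a ∈ T.flatten := by
  rcases getD_nil_mem_or_eq_nil T j with h | h
  · exact List.mem_flatten_of_mem h ha
  · exact absurd (h ▸ ha) List.not_mem_nil

theorem SortedRows.pairwise_getD_nil {α : Type*} [LinearOrder α] {T : List (List α)}
    (hT : SortedRows T) (j : ℕ) : (T.getD j []).Pairwise (· ≤ ·) := by
  rcases getD_nil_mem_or_eq_nil T j with h | h
  · exact (hT _ h).1
  · rw [h]
    exact .nil

theorem eq_of_mem_getD_nil {α : Type*} {T : List (List α)} (hT : T.flatten.Nodup) {a : α}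
    {i j : ℕ} (hi : a ∈ T.getD i []) (hj : a ∈ T.getD j []) : i = j := by
  have lt_length {j : ℕ} (h : a ∈ T.getD j []) : j < T.length := by
    by_contra! hj
    exact List.not_mem_nil (List.getD_eq_default T [] hj ▸ h)
  have disjoint := List.pairwise_iff_getElem.1 (List.nodup_flatten.1 hT).2
  rw [List.getD_eq_getElem _ _ (lt_length hi)] at hi
  rw [List.getD_eq_getElem _ _ (lt_length hj)] at hj
  rcases lt_trichotomy i j with hlt | rfl | hgt
  · exact (disjoint _ _ _ _ hlt hi hj).elim
  · rfl
  · exact (disjoint _ _ _ _ hgt hj hi).elim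

theorem rowOf_eq_iff {α : Type*} [DecidableEq α] {T : List (List α)} (hT : T.flatten.Nodup)
    {a : α} (ha : a ∈ T.flatten) {j : ℕ} : rowOf T a = j ↔ a ∈ T.getD j [] := by
  have findIdx_lt : T.findIdx (fun r => a ∈ r) < T.length :=
    List.findIdx_lt_length_of_exists (by simpa using ha)
  have mem_row : a ∈ T.getD (rowOf T a) [] := by
    rw [rowOf, if_pos ha, List.getD_eq_getElem _ _ findIdx_lt]
    simpa using List.findIdx_getElem (w := findIdx_lt)
  exact ⟨fun h => h ▸ mem_row, eq_of_mem_getD_nil hT mem_row⟩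

theorem Dominates.countP_lt_le {r s : List ℕ} (h : Dominates r s) (m : ℕ) :
    s.countP (· < m) ≤ r.countP (· < m) := by
  induction s generalizing r with
  | nil => exact Nat.zero_le _
  | cons b s ih =>
    cases r with
    | nil => exact h.elim
    | cons a r =>
      have head_le : (if b < m then 1 else 0) ≤ (if a < m then 1 else 0) := by
        have := h.1
        grind
      simpa [List.countP_cons] using add_le_add (ih h.2) head_le

variable {N m : ℕ} {T T' : List (List ℕ)}

theorem shapeAt_rowOf (hT : T.flatten.Perm (List.range N)) (hm : m ≤ N) (j : ℕ) :
    shapeAt m (rowOf T) j = (T.getD j []).countP (· < m) := by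
  have nodup : T.flatten.Nodup := hT.nodup_iff.2 List.nodup_range
  rw [shapeAt, Nat.count_eq_card_filter_range, List.countP_eq_length_filter,
    ← List.toFinset_card_of_nodup ((nodup_getD_nil nodup j).filter _)]
  congr 1
  ext a
  simp only [mem_filter, mem_range, List.mem_toFinset, List.mem_filter, decide_eq_true_eq]
  constructor
  · rintro ⟨ham, haj⟩
    exact ⟨(rowOf_eq_iff nodup (hT.mem_iff.2 (List.mem_range.2 (ham.trans_le hm)))).1 haj, ham⟩
  · rintro ⟨haj, ham⟩
    exact ⟨ham, (rowOf_eq_iff nodup (mem_flatten_of_mem_getD_nil haj)).2 haj⟩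

theorem rowOf_mem_paths (hT : T.flatten.Perm (List.range N)) (hc : T.IsChain Dominates) :
    rowOf T ∈ paths N := by
  refine mem_paths.2 ⟨fun m hm => antitone_nat_of_succ_le fun j => ?_, fun i hi => ?_⟩
  · rw [shapeAt_rowOf hT hm, shapeAt_rowOf hT hm]
    exact (dominates_getD hc j).countP_lt_le m
  · exact if_neg (by simpa [hT.mem_iff] using hi)

theorem shapeAt_rowOf_self (hT : T.flatten.Perm (List.range N)) :
    shapeAt N (rowOf T) = rowLen T := by
  ext j
  rw [shapeAt_rowOf hT le_rfl, rowLen, List.countP_eq_length]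
  intro a ha
  simpa [hT.mem_iff] using mem_flatten_of_mem_getD_nil ha

theorem eq_of_rowOf_eq (hT : T.flatten.Perm (List.range N)) (hT' : T'.flatten.Perm (List.range N))
    (sorted : SortedRows T) (sorted' : SortedRows T') (h : rowOf T = rowOf T') : T = T' := by
  have nodup : T.flatten.Nodup := hT.nodup_iff.2 List.nodup_range
  have nodup' : T'.flatten.Nodup := hT'.nodup_iff.2 List.nodup_range
  refine sorted.eq_of_getD_eq sorted' fun j => ?_
  refine List.Perm.eq_of_pairwise (fun a b _ _ => le_antisymm) (sorted.pairwise_getD_nil j)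
    (sorted'.pairwise_getD_nil j) ?_
  rw [List.perm_ext_iff_of_nodup (nodup_getD_nil nodup j) (nodup_getD_nil nodup' j)]
  have mem_flatten_iff (a : ℕ) : a ∈ T.flatten ↔ a ∈ T'.flatten := (hT.trans hT'.symm).mem_iff
  intro a
  by_cases ha : a ∈ T.flatten
  · rw [← rowOf_eq_iff nodup ha, h, rowOf_eq_iff nodup' ((mem_flatten_iff a).1 ha)]
  · exact iff_of_false (fun haj => ha (mem_flatten_of_mem_getD_nil haj))
      fun haj => ha ((mem_flatten_iff a).2 (mem_flatten_of_mem_getD_nil haj))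

end TableauPath

/-! ### Horizontal strips and skew boxes -/

section Strip

variable {n N i : ℕ} {w v : ℕ → ℕ}

theorem shapeAt_eq_of_ne {x : ℕ} (hn : n ≤ N) (h : ∀ i, n ≤ i → i < N → w i ≠ x) :
    shapeAt N w x = shapeAt n w x := by
  induction N, hn using Nat.le_induction with
  | base => rfl
  | succ N hN ih =>
    rw [shapeAt_succ, addBox_apply, if_neg (h N hN (Nat.lt_succ_self N)).symm,
      ih fun i hi hi' => h i hi (Nat.lt_succ_of_lt hi')]

theorem succ_le_shapeAt (w : ℕ → ℕ) (hi : i < N) :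
    shapeAt i w (w i) + 1 ≤ shapeAt N w (w i) :=
  (by simp [shapeAt_succ, addBox_apply] : shapeAt i w (w i) + 1 = shapeAt (i + 1) w (w i)).trans_le
    (shapeAt_mono hi w _)

theorem le_of_antitoneOn_of_shapeAt_eq (hw : AntitoneOn w (Set.Ico n N))
    (hN : shapeAt N w = shapeAt N v) (hn : n ≤ i) (hi : i < N) (agree : ∀ j < i, w j = v j) :
    v i ≤ w i := by
  by_contra! hlt
  have unchanged : shapeAt N w (v i) = shapeAt i w (v i) :=
    shapeAt_eq_of_ne hi.le fun j hj hj' =>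
      ((hw ⟨hn, hi⟩ ⟨hn.trans hj, hj'⟩ hj).trans_lt hlt).ne
  have grown := succ_le_shapeAt v hi
  rw [← hN, unchanged, shapeAt_congr agree] at grown
  exact Nat.not_succ_le_self _ grown

theorem path_eq_of_antitoneOn (h : ∀ i < n, w i = v i) (hw : AntitoneOn w (Set.Ico n N))
    (hv : AntitoneOn v (Set.Ico n N)) (hN : shapeAt N w = shapeAt N v) (hi : i < N) :
    w i = v i := by
  induction i using Nat.strong_induction_on with
  | _ i ih =>
    rcases lt_or_ge i n with hin | hni
    · exact h i hin
    · have agree : ∀ j < i, w j = v j := fun j hj => ih j hj (hj.trans hi)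
      exact le_antisymm
        (le_of_antitoneOn_of_shapeAt_eq hv hN.symm hni hi fun j hj => (agree j hj).symm)
        (le_of_antitoneOn_of_shapeAt_eq hw hN hni hi agree)

/-- The skew shape between the shapes `l` and `l'` is a horizontal strip, that is, it has no two
boxes in the same column. -/
def IsStrip (l l' : ℕ → ℕ) : Prop := ∀ j, l' (j + 1) ≤ l j

theorem isStrip_of_antitoneOn (hn : n ≤ N) (hw : w ∈ paths N)
    (hanti : AntitoneOn w (Set.Ico n N)) : IsStrip (shapeAt n w) (shapeAt N w) := by
  intro j
  suffices H : ∀ M, n ≤ M → M ≤ N → shapeAt M w (j + 1) ≤ shapeAt n w j from H N hn le_rfl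
  intro M hM
  induction M, hM using Nat.le_induction with
  | base => exact fun h => antitone_shapeAt hw h (Nat.le_succ j)
  | succ M hM ih =>
    intro hMN
    by_cases hj : w M = j + 1
    · have row_unchanged : shapeAt (M + 1) w j = shapeAt n w j :=
        shapeAt_eq_of_ne (hM.trans (Nat.le_succ M)) fun i hi hi' => by
          have := hanti ⟨hi, by lia⟩ ⟨hM, hMN⟩ (Nat.lt_succ_iff.1 hi')
          lia
      exact (antitone_shapeAt hw hMN (Nat.le_succ j)).trans row_unchanged.le
    · rw [shapeAt_succ, addBox_apply, if_neg (Ne.symm hj)]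
      exact ih (by lia)

theorem IsStrip.content_ne (hs : IsStrip (shapeAt n w) (shapeAt N w)) (hw : w ∈ paths N)
    (hn : n ≤ i) (hi : i + 1 < N) : content i w ≠ content (i + 1) w + 1 := by
  intro hc
  have row_ne : w (i + 1) ≠ w i := fun h => by
    rw [content_succ_of_eq h.symm] at hc
    lia
  have col : shapeAt (i + 1) w (w (i + 1)) = shapeAt i w (w (i + 1)) := by
    rw [shapeAt_succ, addBox_apply, if_neg row_ne]
  simp only [content, stepBox, uCoord, col] at hc
  have antitone_i := antitone_shapeAt hw (show i ≤ N by lia)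
  rcases lt_or_gt_of_ne row_ne with above | below
  · have := antitone_i above.le
    lia
  · have := antitone_i below.le
    have row_succ : w (i + 1) = w i + 1 := by lia
    have grown := succ_le_shapeAt w hi
    have strip := hs (w i)
    have grows := shapeAt_mono hn w (w i)
    rw [col] at grown
    rw [← row_succ] at strip
    lia

theorem stepBox_injective (w : ℕ → ℕ) : Function.Injective (stepBox w) := by
  refine Function.Injective.of_lt_imp_ne fun i j hij h => ?_
  obtain ⟨row_eq, col_eq⟩ := Prod.ext_iff.1 h
  have grown := succ_le_shapeAt w hij
  simp only [stepBox] at row_eq col_eq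
  rw [col_eq, row_eq] at grown
  exact Nat.not_succ_le_self _ grown

theorem range_stepBox (n k : ℕ) (w : ℕ → ℕ) :
    Set.range (fun i : Fin k => stepBox w (n + i)) =
      {c | shapeAt n w c.1 ≤ c.2 ∧ c.2 < shapeAt (n + k) w c.1} := by
  apply subset_antisymm
  · rintro _ ⟨i, rfl⟩
    exact ⟨shapeAt_mono (Nat.le_add_right n i) _ _,
      succ_le_shapeAt w (Nat.add_lt_add_left i.isLt n)⟩
  · rintro ⟨x, y⟩ ⟨hle, hlt⟩
    dsimp only at hle hlt
    induction k with
    | zero => exact absurd hlt hle.not_gt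
    | succ k ih =>
      by_cases hy : y < shapeAt (n + k) w x
      · obtain ⟨i, hi⟩ := ih hy
        exact ⟨i.castSucc, hi⟩
      · rw [← add_assoc, shapeAt_succ, addBox_apply] at hlt
        split_ifs at hlt with hx
        · exact ⟨Fin.last k, Prod.ext hx.symm (by simp only [stepBox, Fin.val_last, ← hx]; lia)⟩
        · lia

theorem coe_skewBoxes_rskShape {α : Type*} [LinearOrder α] (l l' : List α) :
    (skewBoxes (rskShape l) (rskShape (l ++ l')) : Set (ℕ × ℕ)) =
      {c | shapeAt l.length (recordingPath (l ++ l')) c.1 ≤ c.2 ∧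
        c.2 < shapeAt (l.length + l'.length) (recordingPath (l ++ l')) c.1} := by
  rw [← List.length_append, shapeAt_recordingPath le_rfl,
    shapeAt_recordingPath (by simp), List.take_left, List.take_length]
  ext c
  simp only [skewBoxes, mem_coe, mem_sdiff, YoungDiagram.mem_cells, mem_rskShape, not_lt,
    Set.mem_ofPred_eq, and_comm]

end Strip

/-! ### The symmetrizer of the last `k` points -/

section Symmetrizer

variable (n k : ℕ)

/-- The embedding of the symmetric group `S_k` into `S_{n+k}` as the permutations of the last `k`
points. -/
def tailPerm : Perm (Fin k) →* Perm (Fin (n + k)) :=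
  (finSumFinEquiv.permCongrHom.toMonoidHom.comp (Perm.sumCongrHom (Fin n) (Fin k))).comp
    (MonoidHom.inr _ _)

/-- The symmetrizer of the last `k` points, acting on the functions on paths of length `n + k` by
Young's seminormal representation. -/
noncomputable def symOp : Module.End ℂ (PathSpace (n + k)) :=
  Representation.averageMap ((seminormal (n + k)).comp (tailPerm n k))

variable {n k}

theorem tailPerm_natAdd (h : Perm (Fin k)) (i : Fin k) :
    tailPerm n k h (Fin.natAdd n i) = Fin.natAdd n (h i) := by
  simp [tailPerm, Equiv.permCongr_apply]

theorem tailPerm_injective : Function.Injective (tailPerm n k) := fun g h e =>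
  Equiv.ext fun i => Fin.natAdd_injective _ n <| by
    rw [← tailPerm_natAdd, e, tailPerm_natAdd]

theorem tailPerm_swap (a b : Fin k) :
    tailPerm n k (swap a b) = swap (Fin.natAdd n a) (Fin.natAdd n b) := by
  change finSumFinEquiv.permCongr (Perm.sumCongr 1 (swap a b)) = _
  rw [Perm.sumCongr_one_swap, permCongr_def, symm_trans_swap_trans, finSumFinEquiv_apply_right,
    finSumFinEquiv_apply_right]

theorem seminormal_tailPerm_swap {i : ℕ} (hi : i + 1 < k) :
    seminormal (n + k) (tailPerm n k (swap ⟨i, Nat.lt_of_succ_lt hi⟩ ⟨i + 1, hi⟩)) =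
      seminormalGen (n + k) (n + i) := by
  rw [tailPerm_swap, ← seminormal_swap (N := n + k) (i := n + i) (Nat.add_lt_add_left hi n)]
  rfl

theorem symOp_eq_smul_sum : symOp n k =
    (k.factorial : ℂ)⁻¹ • ∑ h : Perm (Fin k), seminormal (n + k) (tailPerm n k h) := by
  simp [symOp, GroupAlgebra.average, Fintype.card_perm]

theorem isIdempotentElem_symOp : IsIdempotentElem (symOp n k) :=
  (Representation.isProj_averageMap _).isIdempotentElem

theorem symOp_apply_eq_self {φ : PathSpace (n + k)}
    (hφ : ∀ i, n ≤ i → i + 1 < n + k → seminormalGen (n + k) i φ = φ) : symOp n k φ = φ := by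
  refine Representation.averageMap_id _ φ fun h => ?_
  induction h using perm_fin_induction with
  | one => rw [map_one, Module.End.one_apply]
  | mul i hi σ ih =>
    rw [map_mul, Module.End.mul_apply, ih, MonoidHom.comp_apply, seminormal_tailPerm_swap hi]
    exact hφ _ (Nat.le_add_right n i) (Nat.add_lt_add_left hi n)

theorem commute_mulPath_symOp {g : (ℕ → ℕ) → ℂ}
    (hg : ∀ i, n ≤ i → i + 1 < n + k → ∀ w, g (swapStep i w) = g w) :
    Commute (mulPath (n + k) g) (symOp n k) := by
  suffices H : ∀ h, Commute (mulPath (n + k) g) (seminormal (n + k) (tailPerm n k h)) from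
    symOp_eq_smul_sum (n := n) (k := k) ▸ .smul_right (.sum_right _ _ _ fun h _ => H h) _
  intro h
  induction h using perm_fin_induction with
  | one => simp only [map_one, Commute.one_right]
  | mul i hi σ ih =>
    rw [map_mul, map_mul, seminormal_tailPerm_swap hi]
    exact (commute_mulPath_seminormalGen
      (hg _ (Nat.le_add_right n i) (Nat.add_lt_add_left hi n))).mul_right ih

theorem factorial_mul_dimTrace_symOp :
    (k.factorial : ℂ) * dimTrace (n + k) (symOp n k) = (n + k).factorial := by
  have tailPerm_eq_one_iff (h : Perm (Fin k)) : tailPerm n k h = 1 ↔ h = 1 :=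
    map_eq_one_iff _ tailPerm_injective
  simp [symOp_eq_smul_sum, dimTrace_seminormal, tailPerm_eq_one_iff, k.factorial_ne_zero]

end Symmetrizer

/-! ### Blocks of paths -/

section PathKey

/-- The type of the pairs made of the initial part of a path and of its final shape. -/
abbrev PathKey := (ℕ → ℕ) × (ℕ → ℕ)

variable (n k : ℕ)

/-- The first `n` steps of a path (continued by zeros) together with its shape at time `n + k`. The
paths with a given key are permuted by the exchanges of the steps after time `n`, so they span a
representation of the symmetric group of the last `k` points. -/
def pathKey (w : ℕ → ℕ) : PathKey := (fun i => if i < n then w i else 0, shapeAt (n + k) w)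

/-- The keys of all paths of length `n + k`. -/
noncomputable def pathKeys : Finset PathKey :=
  open Classical in (paths (n + k)).image (pathKey n k)

/-- The indicator function of the set of paths with a given key. -/
noncomputable def keyIndicator (κ : PathKey) : (ℕ → ℕ) → ℂ :=
  Set.indicator {w | pathKey n k w = κ} 1

/-- The dimension of the space of vectors invariant under the permutations of the last `k` points,
in the representation on the paths with key `κ`. -/
noncomputable def keyRank (κ : PathKey) : ℕ :=
  Module.finrank ℂ (symOp n k * mulPath (n + k) (keyIndicator n k κ)).range

variable {n k} {κ : PathKey} {w v : ℕ → ℕ} {i : ℕ}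

theorem pathKey_eq_iff : pathKey n k w = pathKey n k v ↔
    (∀ i < n, w i = v i) ∧ shapeAt (n + k) w = shapeAt (n + k) v := by
  simp only [pathKey, Prod.mk.injEq, funext_iff]
  grind

theorem pathKey_swapStep (hn : n ≤ i) (hi : i + 1 < n + k) (w : ℕ → ℕ) :
    pathKey n k (swapStep i w) = pathKey n k w :=
  pathKey_eq_iff.2 ⟨fun _ _ => swapStep_of_ne (by lia) (by lia) w, shapeAt_swapStep_of_gt hi w⟩

theorem pathKey_mem_pathKeys (hw : w ∈ paths (n + k)) : pathKey n k w ∈ pathKeys n k := by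
  classical exact mem_image_of_mem _ hw

theorem keyIndicator_swapStep (hn : n ≤ i) (hi : i + 1 < n + k) (w : ℕ → ℕ) :
    keyIndicator n k κ (swapStep i w) = keyIndicator n k κ w := by
  by_cases hw : pathKey n k w = κ <;> simp [keyIndicator, pathKey_swapStep hn hi, hw]

theorem isIdempotentElem_keyIndicator (κ : PathKey) : IsIdempotentElem (keyIndicator n k κ) := by
  ext w
  by_cases hw : pathKey n k w = κ <;> simp [keyIndicator, hw]

theorem isIdempotentElem_symOp_mul_keyIndicator (κ : PathKey) :
    IsIdempotentElem (symOp n k * mulPath (n + k) (keyIndicator n k κ)) :=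
  .mul_of_commute (commute_mulPath_symOp fun _ hn hi => keyIndicator_swapStep hn hi).symm
    isIdempotentElem_symOp ((isIdempotentElem_keyIndicator κ).map (mulPath (n + k)))

theorem trace_symOp_mul_keyIndicator (κ : PathKey) :
    LinearMap.trace ℂ _ (symOp n k * mulPath (n + k) (keyIndicator n k κ)) = keyRank n k κ :=
  (LinearMap.IsIdempotentElem.isProj_range _ (isIdempotentElem_symOp_mul_keyIndicator κ)).trace

theorem dimTrace_symOp_mul_keyIndicator (κ : PathKey) :
    dimTrace (n + k) (symOp n k * mulPath (n + k) (keyIndicator n k κ)) =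
      numPaths (n + k) κ.2 * keyRank n k κ := by
  have constant_on_block :
      (keyIndicator n k κ * fun w => (numPaths (n + k) (shapeAt (n + k) w) : ℂ)) =
        (numPaths (n + k) κ.2 : ℂ) • keyIndicator n k κ := by
    ext w
    by_cases hw : pathKey n k w = κ
    · simp [keyIndicator, ← hw, pathKey]
    · simp [keyIndicator, hw]
  rw [dimTrace_apply, LinearMap.trace_mul_comm, mul_assoc, dimOp, ← map_mul, constant_on_block,
    map_smul, mul_smul_comm, map_smul, trace_symOp_mul_keyIndicator, smul_eq_mul]

theorem mulPath_comp_pathKey (Γ : PathKey → ℂ) :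
    mulPath (n + k) (fun w => Γ (pathKey n k w)) =
      ∑ κ ∈ pathKeys n k, Γ κ • mulPath (n + k) (keyIndicator n k κ) := by
  classical
  refine LinearMap.ext fun φ => funext fun w => ?_
  have hw := pathKey_mem_pathKeys w.2
  simp [mulPath_apply, LinearMap.sum_apply, keyIndicator, Set.indicator_apply, hw]

theorem dimTrace_symOp_mul (Γ : PathKey → ℂ) :
    dimTrace (n + k) (symOp n k * mulPath (n + k) fun w => Γ (pathKey n k w)) =
      ∑ κ ∈ pathKeys n k, ((numPaths (n + k) κ.2 * keyRank n k κ : ℕ) : ℂ) * Γ κ := by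
  rw [mulPath_comp_pathKey, mul_sum, map_sum]
  refine sum_congr rfl fun κ _ => ?_
  rw [mul_smul_comm, map_smul, dimTrace_symOp_mul_keyIndicator, smul_eq_mul, mul_comm,
    Nat.cast_mul]

theorem factorial_mul_sum_keyRank :
    k.factorial * ∑ κ ∈ pathKeys n k, numPaths (n + k) κ.2 * keyRank n k κ =
      (n + k).factorial := by
  have total := factorial_mul_dimTrace_symOp (n := n) (k := k)
  rw [← mul_one (symOp n k), ← map_one (mulPath (n + k)), Pi.one_def,
    dimTrace_symOp_mul fun _ => 1] at total
  simp only [mul_one] at total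
  exact_mod_cast total

theorem diagCoeff_add_offCoeff {a b : ℤ} (h : a ≠ b + 1) : diagCoeff a b + offCoeff a b = 1 := by
  rw [offCoeff]
  split_ifs with hab
  · simp [diagCoeff, hab.resolve_right h]
  · ring

/-- In a horizontal strip no two consecutive boxes are in the same column, so that the sum of the
two coefficients in the seminormal form is always `1`. -/
theorem seminormalGen_keyIndicator (hs : IsStrip (shapeAt n w) (shapeAt (n + k) w)) (hn : n ≤ i)
    (hi : i + 1 < n + k) :
    seminormalGen (n + k) i (mulPath (n + k) (keyIndicator n k (pathKey n k w)) 1) =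
      mulPath (n + k) (keyIndicator n k (pathKey n k w)) 1 := by
  ext v
  have off_mul_extend : offCoeff (content i v) (content (i + 1) v) *
      extendPath (n + k) 1 (swapStep i v) = offCoeff (content i v) (content (i + 1) v) := by
    by_cases h : offCoeff (content i v) (content (i + 1) v) = 0
    · rw [h, zero_mul]
    · rw [extendPath_coe 1 ⟨_, swapStep_mem_paths v.2 hi h⟩, Pi.one_apply, mul_one]
  rw [seminormalGen_apply, seminormalOp_apply, extendPath_mulPath, extendPath_mulPath,
    keyIndicator_swapStep hn hi, mul_left_comm _ _ (extendPath _ _ (swapStep i v)),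
    off_mul_extend, extendPath_coe, mulPath_apply, Pi.one_apply, mul_one, mul_comm, ← mul_add]
  by_cases hv : pathKey n k v = pathKey n k w
  · obtain ⟨initial, shape⟩ := pathKey_eq_iff.1 hv
    rw [← shape, ← shapeAt_congr initial] at hs
    rw [diagCoeff_add_offCoeff (hs.content_ne v.2 hn hi), mul_one]
  · simp [keyIndicator, hv]

theorem keyRank_pos (hw : w ∈ paths (n + k)) (hs : IsStrip (shapeAt n w) (shapeAt (n + k) w)) :
    0 < keyRank n k (pathKey n k w) := by
  set E := mulPath (n + k) (keyIndicator n k (pathKey n k w)) with hE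
  have symmetric : symOp n k (E 1) = E 1 :=
    symOp_apply_eq_self fun i hn hi => seminormalGen_keyIndicator hs hn hi
  have ne_zero : E 1 ≠ 0 := fun h => by
    have := congrFun h ⟨w, hw⟩
    simp [hE, mulPath_apply, keyIndicator] at this
  exact Module.finrank_pos_iff_exists_ne_zero.2
    ⟨⟨E 1, 1, symmetric⟩, fun h => ne_zero (congrArg Subtype.val h)⟩

end PathKey

/-! ### Permutations increasing on the last `k` points -/

section TailIncreasing

/-- The one-line word of a permutation, as a list of natural numbers. -/
def permWord {N : ℕ} (σ : Perm (Fin N)) : List ℕ := List.ofFn fun i => (σ i : ℕ)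

theorem length_permWord {N : ℕ} (σ : Perm (Fin N)) : (permWord σ).length = N := List.length_ofFn

theorem permWord_injective {N : ℕ} : Function.Injective (permWord (N := N)) := fun _ _ h =>
  Equiv.ext fun i => Fin.ext (congrFun (List.ofFn_injective h) i)

theorem permWord_perm {N : ℕ} (σ : Perm (Fin N)) : (permWord σ).Perm (List.range N) := by
  simpa [permWord, List.ofFn_eq_map, List.map_coe_finRange_eq_range, Function.comp_def] using
    σ.map_finRange_perm.map Fin.val

theorem flatten_insertionTableau_permWord {N : ℕ} (σ : Perm (Fin N)) :
    (insertionTableau (permWord σ)).flatten.Perm (List.range N) :=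
  (flatten_insertionTableau_perm _).trans (permWord_perm σ)

theorem recordingPath_permWord_mem_paths {N : ℕ} (σ : Perm (Fin N)) :
    recordingPath (permWord σ) ∈ paths N := by
  simpa only [length_permWord] using recordingPath_mem_paths (permWord σ)

theorem shapeAt_recordingPath_permWord {N : ℕ} (σ : Perm (Fin N)) :
    shapeAt N (recordingPath (permWord σ)) = rowLen (insertionTableau (permWord σ)) := by
  have := shapeAt_recordingPath (l := permWord σ) le_rfl
  rwa [List.take_length, length_permWord] at this

variable (n k : ℕ)

/-- The permutations that are increasing on the last `k` points. -/
noncomputable def tailIncreasing : Finset (Perm (Fin (n + k))) :=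
  open Classical in {σ | StrictMono fun i : Fin k => σ (Fin.natAdd n i)}

/-- The permutations that are increasing on the last `k` points and whose recording path has the
key `κ`. -/
noncomputable def tailIncreasingWithKey (κ : PathKey) : Finset (Perm (Fin (n + k))) :=
  open Classical in {σ ∈ tailIncreasing n k | pathKey n k (recordingPath (permWord σ)) = κ}

variable {n k} {κ : PathKey} {σ : Perm (Fin (n + k))}

theorem mem_tailIncreasing :
    σ ∈ tailIncreasing n k ↔ StrictMono fun i : Fin k => σ (Fin.natAdd n i) := by
  simp [tailIncreasing]

theorem one_mem_tailIncreasing : 1 ∈ tailIncreasing n k :=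
  mem_tailIncreasing.2 (Fin.strictMono_natAdd n)

theorem mem_tailIncreasingWithKey : σ ∈ tailIncreasingWithKey n k κ ↔
    σ ∈ tailIncreasing n k ∧ pathKey n k (recordingPath (permWord σ)) = κ := by
  simp [tailIncreasingWithKey]

theorem antitoneOn_recordingPath_permWord (hσ : σ ∈ tailIncreasing n k) :
    AntitoneOn (recordingPath (permWord σ)) (Set.Ico n (n + k)) := by
  refine antitoneOn_of_succ_le Set.ordConnected_Ico fun i _ ⟨hn, _⟩ ⟨_, hi⟩ => ?_
  obtain ⟨j, rfl⟩ := Nat.exists_eq_add_of_le hn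
  have hj : j + 1 < k := Nat.lt_of_add_lt_add_left hi
  refine recordingPath_succ_le ((length_permWord σ).symm ▸ hi) ?_
  simp only [permWord, List.getElem_ofFn]
  exact (mem_tailIncreasing.1 hσ
    (show (⟨j, Nat.lt_of_succ_lt hj⟩ : Fin k) < ⟨j + 1, hj⟩ from Nat.lt_succ_self j)).le

theorem recordingPath_eq_of_pathKey_eq {τ : Perm (Fin (n + k))} (hσ : σ ∈ tailIncreasing n k)
    (hτ : τ ∈ tailIncreasing n k)
    (h : pathKey n k (recordingPath (permWord σ)) = pathKey n k (recordingPath (permWord τ))) :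
    recordingPath (permWord σ) = recordingPath (permWord τ) := by
  obtain ⟨initial, shape⟩ := pathKey_eq_iff.1 h
  ext i
  rcases lt_or_ge i (n + k) with hi | hi
  · exact path_eq_of_antitoneOn initial (antitoneOn_recordingPath_permWord hσ)
      (antitoneOn_recordingPath_permWord hτ) shape hi
  · rw [(mem_paths.1 (recordingPath_permWord_mem_paths σ)).2 i hi,
      (mem_paths.1 (recordingPath_permWord_mem_paths τ)).2 i hi]

theorem card_tailIncreasingWithKey_le_numPaths (κ : PathKey) :
    #(tailIncreasingWithKey n k κ) ≤ numPaths (n + k) κ.2 := by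
  classical
  refine card_le_card_of_injOn (fun σ => rowOf (insertionTableau (permWord σ)))
    (fun σ hσ => ?_) fun σ hσ τ hτ h => ?_
  · obtain ⟨_, rfl⟩ := mem_tailIncreasingWithKey.1 hσ
    have flatten := flatten_insertionTableau_permWord σ
    refine mem_filter.2 ⟨rowOf_mem_paths flatten (isChain_insertionTableau _), ?_⟩
    rw [shapeAt_rowOf_self flatten, ← shapeAt_recordingPath_permWord]
    rfl
  · obtain ⟨hσ, σ_key⟩ := mem_tailIncreasingWithKey.1 hσ
    obtain ⟨hτ, τ_key⟩ := mem_tailIncreasingWithKey.1 hτ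
    have tableau_eq := eq_of_rowOf_eq (flatten_insertionTableau_permWord σ)
      (flatten_insertionTableau_permWord τ) (sortedRows_insertionTableau _)
      (sortedRows_insertionTableau _) h
    exact permWord_injective <| eq_of_insertionTableau_eq (by simp only [length_permWord])
      tableau_eq (recordingPath_eq_of_pathKey_eq hσ hτ (σ_key.trans τ_key.symm))

theorem card_tailIncreasingWithKey_le (κ : PathKey) :
    #(tailIncreasingWithKey n k κ) ≤ numPaths (n + k) κ.2 * keyRank n k κ := by
  rcases (tailIncreasingWithKey n k κ).eq_empty_or_nonempty with h | ⟨σ, hσ⟩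
  · simp [h]
  · obtain ⟨increasing, rfl⟩ := mem_tailIncreasingWithKey.1 hσ
    have rank_pos := keyRank_pos (recordingPath_permWord_mem_paths σ) <|
      isStrip_of_antitoneOn (Nat.le_add_right n k) (recordingPath_permWord_mem_paths σ)
        (antitoneOn_recordingPath_permWord increasing)
    exact (card_tailIncreasingWithKey_le_numPaths _).trans (Nat.le_mul_of_pos_right _ rank_pos)

theorem factorial_le_factorial_mul_card_tailIncreasing :
    (n + k).factorial ≤ k.factorial * #(tailIncreasing n k) := by
  have surjective : Function.Surjective fun p : Perm (Fin k) × tailIncreasing n k =>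
      p.2.1 * tailPerm n k p.1 := by
    intro σ
    let f : Fin k → Fin (n + k) := fun i => σ (Fin.natAdd n i)
    have f_injective : Function.Injective f := σ.injective.comp (Fin.natAdd_injective k n)
    have sorted : StrictMono (f ∘ Tuple.sort f) :=
      (Tuple.monotone_sort f).strictMono_of_injective (f_injective.comp (Tuple.sort f).injective)
    have increasing : σ * tailPerm n k (Tuple.sort f) ∈ tailIncreasing n k :=
      mem_tailIncreasing.2 (by simpa [f, Function.comp_def, tailPerm_natAdd] using sorted)
    exact ⟨((Tuple.sort f)⁻¹, ⟨_, increasing⟩), by simp⟩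
  simpa [Fintype.card_perm] using Fintype.card_le_of_surjective _ surjective

theorem mapsTo_tailIncreasing_pathKeys :
    ∀ σ ∈ tailIncreasing n k, pathKey n k (recordingPath (permWord σ)) ∈ pathKeys n k :=
  fun σ _ => pathKey_mem_pathKeys (recordingPath_permWord_mem_paths σ)

theorem sum_card_tailIncreasingWithKey :
    ∑ κ ∈ pathKeys n k, #(tailIncreasingWithKey n k κ) = #(tailIncreasing n k) := by
  classical exact (card_eq_sum_card_fiberwise mapsTo_tailIncreasing_pathKeys).symm

/-- The upper bounds on the numbers of permutations sum up to the true total, so they are all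
attained. -/
theorem card_tailIncreasingWithKey (hκ : κ ∈ pathKeys n k) :
    #(tailIncreasingWithKey n k κ) = numPaths (n + k) κ.2 * keyRank n k κ := by
  refine (sum_eq_sum_iff_of_le fun κ _ => card_tailIncreasingWithKey_le κ).1
    (le_antisymm (sum_le_sum fun κ _ => card_tailIncreasingWithKey_le κ) ?_) κ hκ
  refine le_of_mul_le_mul_left ?_ k.factorial_pos
  rw [factorial_mul_sum_keyRank, sum_card_tailIncreasingWithKey]
  exact factorial_le_factorial_mul_card_tailIncreasing

theorem factorial_mul_card_tailIncreasing :
    k.factorial * #(tailIncreasing n k) = (n + k).factorial := by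
  rw [← factorial_mul_sum_keyRank, ← sum_card_tailIncreasingWithKey]
  exact congrArg _ (sum_congr rfl fun κ hκ => card_tailIncreasingWithKey hκ)

theorem sum_tailIncreasing (Γ : PathKey → ℂ) :
    ∑ σ ∈ tailIncreasing n k, Γ (pathKey n k (recordingPath (permWord σ))) =
      dimTrace (n + k) (symOp n k * mulPath (n + k) fun w => Γ (pathKey n k w)) := by
  classical
  rw [dimTrace_symOp_mul, ← sum_fiberwise_of_maps_to mapsTo_tailIncreasing_pathKeys]
  refine sum_congr rfl fun κ hκ => ?_
  rw [← card_tailIncreasingWithKey hκ, ← nsmul_eq_mul, ← sum_const]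
  exact sum_congr rfl fun σ hσ => congrArg Γ (mem_filter.1 hσ).2

end TailIncreasing

/-! ### Characters of the Jucys–Murphy elements -/

section Characters

variable {G : Type*} [Group G]

theorem character_leftRegular [Fintype G] [DecidableEq G] (g : G) :
    (Representation.leftRegular ℂ G).character g = if g = 1 then (Fintype.card G : ℂ) else 0 := by
  have diagonal (x : G) : LinearMap.toMatrix (MonoidAlgebra.basis G ℂ) (MonoidAlgebra.basis G ℂ)
      (Representation.leftRegular ℂ G g) x x = if g = 1 then 1 else 0 := by
    rw [LinearMap.toMatrix_apply, MonoidAlgebra.basis_apply, Representation.ofMulAction_single]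
    change (MonoidAlgebra.single (g • x) (1 : ℂ)).coeff x = _
    simp [Finsupp.single_apply]
  rw [Representation.character, LinearMap.trace_eq_matrix_trace ℂ (MonoidAlgebra.basis G ℂ),
    Matrix.trace]
  simp [Matrix.diag_apply, diagonal]

theorem chiReg_apply [Finite G] [DecidableEq G] (g : G) : chiReg G g = if g = 1 then 1 else 0 := by
  cases nonempty_fintype G
  rw [chiReg, normalizedCharacter, character_leftRegular,
    Module.finrank_eq_card_basis (MonoidAlgebra.basis G ℂ), ite_div, zero_div,
    div_self (Nat.cast_ne_zero.2 Fintype.card_ne_zero)]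

theorem chiTriv_apply (g : G) : chiTriv G g = 1 := by
  have : Representation.trivial ℂ G ℂ g = 1 := rfl
  simp [chiTriv, normalizedCharacter, Representation.character, this]

variable {n k N : ℕ}

theorem charApply_restrictYoung (F : MonoidAlgebra ℂ (Perm (Fin (n + k)))) :
    charApply (tensorChar (chiReg (Perm (Fin n))) (chiTriv (Perm (Fin k)))) (restrictYoung F) =
      ∑ h, F.coeff (tailPerm n k h) := by
  have coeff_one_inr (h : Perm (Fin k)) :
      (restrictYoung F).coeff (1, h) = F.coeff (tailPerm n k h) := rfl
  rw [charApply, Fintype.sum_prod_type_right]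
  simp [tensorChar, chiReg_apply, chiTriv_apply, coeff_one_inr]

theorem dimTrace_seminormal_mul_asAlgebraHom (σ : Perm (Fin N))
    (F : MonoidAlgebra ℂ (Perm (Fin N))) :
    dimTrace N (seminormal N σ * Representation.asAlgebraHom (seminormal N) F) =
      N.factorial * F.coeff σ⁻¹ := by
  rw [Representation.asAlgebraHom_def, MonoidAlgebra.lift_apply,
    Finsupp.sum_fintype _ (fun τ c => c • seminormal N τ) fun _ => zero_smul ℂ _]
  simp [mul_sum, ← map_mul, dimTrace_seminormal, mul_eq_one_iff_inv_eq, mul_comm]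

theorem factorial_mul_dimTrace_symOp_mul_asAlgebraHom (F : MonoidAlgebra ℂ (Perm (Fin (n + k)))) :
    k.factorial * dimTrace (n + k)
        (symOp n k * Representation.asAlgebraHom (seminormal (n + k)) F) =
      (n + k).factorial * ∑ h, F.coeff (tailPerm n k h) := by
  rw [symOp_eq_smul_sum, smul_mul_assoc, map_smul, smul_eq_mul,
    mul_inv_cancel_left₀ (Nat.cast_ne_zero.2 k.factorial_ne_zero), sum_mul, map_sum, mul_sum]
  refine Fintype.sum_equiv (Equiv.inv _) _ _ fun h => ?_
  rw [dimTrace_seminormal_mul_asAlgebraHom, Equiv.inv_apply, map_inv (tailPerm n k)]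

theorem asAlgebraHom_jucysMurphy (i : Fin N) :
    Representation.asAlgebraHom (seminormal N) (jucysMurphy i) =
      mulPath N fun w => content i w := by
  simp only [jucysMurphy, map_sum, Representation.asAlgebraHom_of]
  exact sum_seminormal_swap i.isLt

theorem map_evalCommuting {R S T : Type*} [Ring R] [Ring S] [CommRing T] [Algebra ℂ R]
    [Algebra ℂ S] [Algebra ℂ T] (f : R →ₐ[ℂ] S) (g : T →ₐ[ℂ] S) {a : Fin k → R} {b : Fin k → T}
    (ha : ∀ i j, Commute (a i) (a j)) (hab : ∀ i, f (a i) = g (b i))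
    (P : MvPolynomial (Fin k) ℂ) : f (evalCommuting a ha P) = g (MvPolynomial.aeval b P) := by
  rw [evalCommuting, MvPolynomial.aeval_def, MvPolynomial.eval₂_eq', map_sum, map_sum]
  refine sum_congr rfl fun m _ => ?_
  rw [← Algebra.smul_def, map_smul, map_smul, ← noncommProd_eq_prod]
  refine congrArg _ ((Finset.map_noncommProd _ _ _ f).trans
    ((noncommProd_congr rfl (fun i _ => ?_) _).trans (Finset.map_noncommProd _ _ _ g).symm))
  rw [map_pow, map_pow, hab]

/-- The value of a polynomial at the contents of the boxes added by a path `w` at the times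
`n, …, n + k - 1`. -/
noncomputable def contentEval (n : ℕ) (P : MvPolynomial (Fin k) ℂ) (w : ℕ → ℕ) : ℂ :=
  MvPolynomial.eval (fun i : Fin k => (content (n + i) w : ℂ)) P

theorem asAlgebraHom_evalJucysMurphy (P : MvPolynomial (Fin k) ℂ) :
    Representation.asAlgebraHom (seminormal (n + k)) (evalJucysMurphy n P) =
      mulPath (n + k) (contentEval n P) := by
  have generator (i : Fin k) :
      Representation.asAlgebraHom (seminormal (n + k)) (jucysMurphy (Fin.natAdd n i)) =
        mulPath (n + k) fun w => content (n + i) w := asAlgebraHom_jucysMurphy _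
  rw [evalJucysMurphy, map_evalCommuting _ (mulPath (n + k)) _ generator]
  congr 1
  ext w
  rw [contentEval, MvPolynomial.aeval_def, MvPolynomial.eval₂_eq', MvPolynomial.eval_eq']
  simp

theorem eval_comp_eq_of_range_eq {σ β R : Type*} [CommSemiring R] {P : MvPolynomial σ R}
    (hP : P.IsSymmetric) {f f' : σ → β} (hf : Function.Injective f)
    (hf' : Function.Injective f') (h : Set.range f = Set.range f') (g : β → R) :
    MvPolynomial.eval (g ∘ f) P = MvPolynomial.eval (g ∘ f') P := by
  let e : Perm σ := (ofInjective f hf).trans ((setCongr h).trans (ofInjective f' hf').symm)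
  have reindex : f' ∘ e = f :=
    funext fun i => apply_ofInjective_symm hf' (setCongr h (ofInjective f hf i))
  conv_rhs => rw [← hP e, MvPolynomial.eval_rename, Function.comp_assoc, reindex]

variable {P : MvPolynomial (Fin k) ℂ}

theorem eval_uCoord_eq_contentEval (hP : P.IsSymmetric) {f : Fin k → ℕ × ℕ}
    (hf : Function.Injective f) {w : ℕ → ℕ}
    (range_eq : Set.range f = Set.range fun i : Fin k => stepBox w (n + i)) :
    MvPolynomial.eval (fun i => (uCoord (f i) : ℂ)) P = contentEval n P w :=
  eval_comp_eq_of_range_eq hP hf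
    (fun _ _ h => Fin.ext (Nat.add_left_cancel (stepBox_injective w h))) range_eq
    fun c => (uCoord c : ℂ)

theorem contentEval_factorsThrough_pathKey (hP : P.IsSymmetric) :
    (contentEval n P).FactorsThrough (pathKey n k) := by
  intro w v h
  obtain ⟨initial, shape⟩ := pathKey_eq_iff.1 h
  refine eval_uCoord_eq_contentEval hP
    (fun _ _ h => Fin.ext (Nat.add_left_cancel (stepBox_injective w h))) ?_
  rw [range_stepBox, range_stepBox, shape, shapeAt_congr initial]

theorem sum_tailIncreasing_contentEval (hP : P.IsSymmetric) :
    ∑ σ ∈ tailIncreasing n k, contentEval n P (recordingPath (permWord σ)) =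
      #(tailIncreasing n k) *
        charApply (tensorChar (chiReg (Perm (Fin n))) (chiTriv (Perm (Fin k))))
          (restrictYoung (evalJucysMurphy n P)) := by
  obtain ⟨Γ, factor⟩ :=
    (Function.factorsThrough_iff _).1 (contentEval_factorsThrough_pathKey (n := n) hP)
  have sum_eq_dimTrace := sum_tailIncreasing (n := n) (k := k) Γ
  have dimTrace_eq := factorial_mul_dimTrace_symOp_mul_asAlgebraHom (evalJucysMurphy n P)
  rw [asAlgebraHom_evalJucysMurphy, ← charApply_restrictYoung,
    ← factorial_mul_card_tailIncreasing, Nat.cast_mul, mul_assoc] at dimTrace_eq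
  simp only [factor] at dimTrace_eq ⊢
  exact sum_eq_dimTrace.trans
    (mul_left_cancel₀ (Nat.cast_ne_zero.2 k.factorial_ne_zero) dimTrace_eq)

end Characters

/-! ### The relative order of the sample -/

section OrderCell

variable {n k N : ℕ}

/-- The unit cube of dimension `N`. -/
def unitCube (N : ℕ) : Set (Fin N → ℝ) := Set.univ.pi fun _ => Set.Icc 0 1

/-- The points of the unit cube whose coordinates are in the same relative order as the values
of `σ`. -/
def orderCell (σ : Perm (Fin N)) : Set (Fin N → ℝ) :=
  unitCube N ∩ {z | StrictMono (z ∘ (σ⁻¹ : Perm (Fin N)))}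

/-- The points of the unit cube whose last `k` coordinates are weakly increasing. -/
def tailCube (n k : ℕ) : Set (Fin (n + k) → ℝ) :=
  unitCube (n + k) ∩ {z | Monotone fun i : Fin k => z (Fin.natAdd n i)}

theorem measurableSet_unitCube : MeasurableSet (unitCube N) :=
  .univ_pi fun _ => measurableSet_Icc

theorem volume_unitCube : volume (unitCube N) = 1 := by
  rw [unitCube, volume_pi_pi]
  simp

theorem orderedCube_eq : orderedCube k = unitCube k ∩ {z | Monotone z} := by
  ext z
  simp only [orderedCube, unitCube, Set.mem_inter_iff, Set.mem_univ_pi, Set.mem_ofPred_eq]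

theorem volume_orderedCube_ne_top : volume (orderedCube k) ≠ ⊤ :=
  measure_ne_top_of_subset (orderedCube_eq ▸ Set.inter_subset_left)
    (volume_unitCube ▸ ENNReal.one_ne_top)

theorem measurableSet_setOf_strictMono {ι : Type*} [Preorder ι] [Countable ι] :
    MeasurableSet {z : ι → ℝ | StrictMono z} := by
  simp only [StrictMono, Set.ofPred_forall]
  exact .iInter fun i => .iInter fun j => .iInter fun _ =>
    measurableSet_lt (measurable_pi_apply i) (measurable_pi_apply j)

theorem measurePreserving_comp_perm {ι α : Type*} [Fintype ι] [MeasureSpace α]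
    [SigmaFinite (volume : Measure α)] (σ : Perm ι) :
    MeasurePreserving fun z : ι → α => z ∘ σ :=
  volume_preserving_arrowCongr' σ⁻¹ (.refl α) (.id volume)

theorem ae_injective {ι : Type*} [Fintype ι] : ∀ᵐ z : ι → ℝ, Function.Injective z := by
  classical
  suffices H : ∀ i j, i ≠ j → ∀ᵐ z : ι → ℝ, z i ≠ z j by
    simp only [Function.Injective, ae_all_iff]
    intro i j
    by_cases hij : i = j
    · simp [hij]
    · filter_upwards [H i j hij] with z hz h using absurd h hz
  intro i j hij
  let difference : (ι → ℝ) →ₗ[ℝ] ℝ :=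
    LinearMap.proj (R := ℝ) (φ := fun _ : ι => ℝ) i - LinearMap.proj j
  have ker_ne_top : LinearMap.ker difference ≠ ⊤ := fun h => by
    have mem_ker : (Pi.single i 1 : ι → ℝ) ∈ LinearMap.ker difference := h ▸ Submodule.mem_top
    simp [difference, hij.symm] at mem_ker
  have null := Measure.addHaar_submodule (volume : Measure (ι → ℝ)) _ ker_ne_top
  rw [ae_iff]
  convert null using 2
  ext z
  simp [difference, sub_eq_zero]

theorem lt_iff_of_mem_orderCell {σ : Perm (Fin N)} {z : Fin N → ℝ} (hz : z ∈ orderCell σ)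
    (i j : Fin N) : z i < z j ↔ σ i < σ j := by
  simpa using hz.2.lt_iff_lt (a := σ i) (b := σ j)

theorem orderCell_eq_preimage (σ : Perm (Fin N)) :
    orderCell σ = (fun z : Fin N → ℝ => z ∘ (σ⁻¹ : Perm (Fin N))) ⁻¹' orderCell 1 := by
  ext z
  simp only [orderCell, unitCube, Set.mem_inter_iff, Set.mem_univ_pi, Set.mem_preimage,
    Set.mem_ofPred_eq, inv_one, Perm.coe_one, Function.comp_id, Function.comp_apply,
    (σ⁻¹ : Perm (Fin N)).forall_congr_right (q := fun i => z i ∈ Set.Icc 0 1)]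

theorem measurableSet_orderCell (σ : Perm (Fin N)) : MeasurableSet (orderCell σ) :=
  measurableSet_unitCube.inter
    ((measurePreserving_comp_perm _).measurable measurableSet_setOf_strictMono)

theorem volume_orderCell (σ : Perm (Fin N)) :
    volume (orderCell σ) = volume (orderCell (1 : Perm (Fin N))) := by
  rw [orderCell_eq_preimage,
    (measurePreserving_comp_perm _).measure_preimage (measurableSet_orderCell 1).nullMeasurableSet]

theorem pairwise_disjoint_orderCell : Pairwise (Function.onFun Disjoint (orderCell (N := N))) := by
  refine fun σ τ hne => Set.disjoint_left.2 fun z hσ hτ => hne ?_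
  have injective : Function.Injective z := by
    simpa using hσ.2.injective
  have comp_eq := (hσ.2.range_inj hτ.2).1 (by simp [EquivLike.range_comp])
  exact inv_injective (Equiv.ext fun i => injective (congrFun comp_eq i))

theorem exists_mem_orderCell {z : Fin N → ℝ} (hz : z ∈ unitCube N) (hinj : Function.Injective z) :
    ∃ σ, z ∈ orderCell σ := by
  refine ⟨(Tuple.sort z)⁻¹, hz, ?_⟩
  rw [inv_inv]
  exact (Tuple.monotone_sort z).strictMono_of_injective (hinj.comp (Tuple.sort z).injective)

theorem volume_orderCell_ne_zero (σ : Perm (Fin N)) : volume (orderCell σ) ≠ 0 := by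
  intro null
  have cover : unitCube N ≤ᵐ[volume] ⋃ τ : Perm (Fin N), orderCell τ := by
    filter_upwards [ae_injective] with z hinj hz using
      Set.mem_iUnion.2 (exists_mem_orderCell hz hinj)
  have null_union : volume (⋃ τ : Perm (Fin N), orderCell τ) = 0 :=
    measure_iUnion_null fun τ => by rw [volume_orderCell, ← volume_orderCell σ, null]
  exact one_ne_zero (volume_unitCube.symm.trans (measure_mono_null_ae cover null_union))

theorem volume_orderedCube_ne_zero : volume (orderedCube k) ≠ 0 := by
  have cell_subset : orderCell (1 : Perm (Fin k)) ⊆ orderedCube k :=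
    orderedCube_eq ▸ Set.inter_subset_inter_right _ fun _ hz => hz.monotone
  exact fun null => volume_orderCell_ne_zero 1 (measure_mono_null cell_subset null)

theorem measurableSet_tailCube : MeasurableSet (tailCube n k) :=
  measurableSet_unitCube.inter <| by
    simp only [Monotone, Set.ofPred_forall]
    exact .iInter fun i => .iInter fun j => .iInter fun _ =>
      measurableSet_le (measurable_pi_apply _) (measurable_pi_apply _)

theorem orderCell_subset_tailCube {σ : Perm (Fin (n + k))} (hσ : σ ∈ tailIncreasing n k) :
    orderCell σ ⊆ tailCube n k := fun _ hz => ⟨hz.1, StrictMono.monotone fun _ _ hij =>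
      (lt_iff_of_mem_orderCell hz _ _).2 (mem_tailIncreasing.1 hσ hij)⟩

theorem mem_tailIncreasing_of_mem_orderCell {σ : Perm (Fin (n + k))} {z : Fin (n + k) → ℝ}
    (hz : z ∈ orderCell σ) (hz' : z ∈ tailCube n k) : σ ∈ tailIncreasing n k :=
  mem_tailIncreasing.2 <| Monotone.strictMono_of_injective
    (fun _ _ hij => not_lt.1 fun h =>
      (hz'.2 hij).not_gt ((lt_iff_of_mem_orderCell hz _ _).2 h))
    (σ.injective.comp (Fin.natAdd_injective k n))

theorem ae_exists_mem_orderCell :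
    ∀ᵐ z ∂volume.restrict (tailCube n k), ∃ σ ∈ tailIncreasing n k, z ∈ orderCell σ := by
  filter_upwards [ae_restrict_mem measurableSet_tailCube, ae_restrict_of_ae ae_injective]
    with z hz hinj
  obtain ⟨σ, hσ⟩ := exists_mem_orderCell hz.1 hinj
  exact ⟨σ, mem_tailIncreasing_of_mem_orderCell hσ hz, hσ⟩

theorem measurePreserving_append {α : Type*} [MeasureSpace α]
    [SigmaFinite (volume : Measure α)] :
    MeasurePreserving fun p : (Fin n → α) × (Fin k → α) => Fin.append p.1 p.2 := by
  have append_eq : (fun p : (Fin n → α) × (Fin k → α) => Fin.append p.1 p.2) =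
      MeasurableEquiv.piCongrLeft (fun _ => α) finSumFinEquiv ∘
        (MeasurableEquiv.sumPiEquivProdPi fun _ : Fin n ⊕ Fin k => α).symm := by
    refine funext fun p => funext fun i => ?_
    obtain ⟨j, rfl⟩ := finSumFinEquiv.surjective i
    rw [Function.comp_apply, MeasurableEquiv.piCongrLeft_apply_apply]
    cases j <;> simp [MeasurableEquiv.sumPiEquivProdPi, Equiv.sumPiEquivProdPi]
  rw [append_eq]
  exact (volume_measurePreserving_piCongrLeft _ finSumFinEquiv).comp
    (volume_measurePreserving_sumPiEquivProdPi_symm fun _ => α)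

theorem append_preimage_tailCube :
    (fun p : (Fin n → ℝ) × (Fin k → ℝ) => Fin.append p.1 p.2) ⁻¹' tailCube n k =
      unitCube n ×ˢ orderedCube k := by
  ext p
  simp only [tailCube, unitCube, orderedCube_eq, Set.mem_preimage, Set.mem_inter_iff,
    Set.mem_univ_pi, Set.mem_ofPred_eq, Set.mem_prod, Fin.forall_fin_add, Fin.append_left,
    Fin.append_right, and_assoc]

theorem volume_tailCube : volume (tailCube n k) = volume (orderedCube k) := by
  rw [← measurePreserving_append.measure_preimage measurableSet_tailCube.nullMeasurableSet,
    append_preimage_tailCube, Measure.volume_eq_prod, Measure.prod_prod, volume_unitCube, one_mul]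

theorem volume_tailCube_ne_zero : volume (tailCube n k) ≠ 0 :=
  volume_tailCube.trans_ne volume_orderedCube_ne_zero

theorem volume_tailCube_ne_top : volume (tailCube n k) ≠ ⊤ :=
  volume_tailCube.trans_ne volume_orderedCube_ne_top

end OrderCell

/-! ### Uniform laws and equally likely events -/

section UniformLaw

variable {Ω E F : Type*} [MeasurableSpace Ω] [MeasurableSpace E] [MeasurableSpace F]
  {μ : Measure Ω} {ν : Measure E} {ν' : Measure F} {s : Set E} {t : Set F}

theorem isUniform_prodMk [IsFiniteMeasure μ] [SFinite ν] [SFinite ν'] {X : Ω → E} {Y : Ω → F}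
    (hs : ν s ≠ 0) (hs' : ν s ≠ ⊤) (ht : ν' t ≠ 0) (ht' : ν' t ≠ ⊤)
    (hX : pdf.IsUniform X s μ ν) (hY : pdf.IsUniform Y t μ ν') (hXY : IndepFun X Y μ) :
    pdf.IsUniform (fun ω => (X ω, Y ω)) (s ×ˢ t) μ (ν.prod ν') := by
  have law_eq := hXY.map_prod_eq_prod_map_map (hX.aemeasurable hs hs') (hY.aemeasurable ht ht')
  rw [hX, hY] at law_eq
  rw [pdf.IsUniform, law_eq]
  simp only [ProbabilityTheory.cond]
  rw [Measure.prod_smul_left, Measure.prod_smul_right, smul_smul, Measure.prod_restrict,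
    Measure.prod_prod, ENNReal.mul_inv (.inl hs) (.inl hs')]

theorem isUniform_comp {X : Ω → E} {g : E → F} (hg : MeasurePreserving g ν ν')
    (ht : MeasurableSet t) (hX : AEMeasurable X μ) (hunif : pdf.IsUniform X (g ⁻¹' t) μ ν) :
    pdf.IsUniform (fun ω => g (X ω)) t μ ν' := by
  have law_eq := AEMeasurable.map_map_of_aemeasurable hg.measurable.aemeasurable hX
  rw [pdf.IsUniform, ← Function.comp_def, ← law_eq, hunif, ProbabilityTheory.cond,
    Measure.map_smul, (hg.restrict_preimage ht).map_eq, hg.measure_preimage ht.nullMeasurableSet,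
    ProbabilityTheory.cond]

theorem isUniform_pi_Icc {ι : Type*} [Fintype ι] [IsProbabilityMeasure μ] {A : ι → Ω → ℝ}
    (hA : ∀ i, pdf.IsUniform (A i) (Set.Icc (0 : ℝ) 1) μ volume) (hindep : iIndepFun A μ) :
    pdf.IsUniform (fun ω i => A i ω) (Set.univ.pi fun _ => Set.Icc (0 : ℝ) 1) μ volume := by
  have volume_Icc : volume (Set.Icc (0 : ℝ) 1) = 1 := by simp
  have aemeasurable (i : ι) : AEMeasurable (A i) μ :=
    (hA i).aemeasurable (by simp) (by simp)
  have law_eq (i : ι) : μ.map (A i) = volume.restrict (Set.Icc (0 : ℝ) 1) := by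
    rw [hA i, ProbabilityTheory.cond, volume_Icc, inv_one, one_smul]
  rw [pdf.IsUniform, (iIndepFun_iff_map_fun_eq_pi_map aemeasurable).1 hindep,
    ProbabilityTheory.cond, volume_pi_pi, volume_Icc, prod_const_one, inv_one, one_smul,
    volume_pi, Measure.restrict_pi_pi]
  exact congrArg Measure.pi (funext law_eq)

end UniformLaw

/-- The events `c i`, `i ∈ s`, partition the measure space up to a null set. -/
structure IsAEPartition {Ω ι : Type*} [MeasurableSpace Ω] (μ : Measure Ω) (s : Finset ι)
    (c : ι → Set Ω) : Prop where
  nullMeasurableSet : ∀ i ∈ s, NullMeasurableSet (c i) μ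
  pairwiseDisjoint : (s : Set ι).PairwiseDisjoint c
  ae_exists_mem : ∀ᵐ ω ∂μ, ∃ i ∈ s, ω ∈ c i

namespace IsAEPartition

variable {Ω ι E : Type*} [MeasurableSpace Ω] {μ : Measure Ω} {s : Finset ι} {c : ι → Set Ω}
  [NormedAddCommGroup E] {f : Ω → E} {g : ι → E}

theorem ae_eq_sum_indicator (hc : IsAEPartition μ s c) (hf : ∀ i ∈ s, ∀ ω ∈ c i, f ω = g i) :
    f =ᵐ[μ] fun ω => ∑ i ∈ s, (c i).indicator (fun _ => g i) ω := by
  filter_upwards [hc.ae_exists_mem] with ω ⟨i, hi, hω⟩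
  rw [sum_eq_single_of_mem i hi fun j hj hji => Set.indicator_of_notMem
    (fun hω' => (hc.pairwiseDisjoint hj hi hji).le_bot ⟨hω', hω⟩) _,
    Set.indicator_of_mem hω, hf i hi ω hω]

theorem integrable [IsFiniteMeasure μ] (hc : IsAEPartition μ s c)
    (hf : ∀ i ∈ s, ∀ ω ∈ c i, f ω = g i) : Integrable f μ :=
  (integrable_finsetSum _ fun i hi =>
    (integrable_const (g i)).indicator₀ (hc.nullMeasurableSet i hi)).congr
      (hc.ae_eq_sum_indicator hf).symm

variable [NormedSpace ℝ E] [CompleteSpace E]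

theorem integral_eq_sum [IsFiniteMeasure μ] (hc : IsAEPartition μ s c)
    (hf : ∀ i ∈ s, ∀ ω ∈ c i, f ω = g i) : ∫ ω, f ω ∂μ = ∑ i ∈ s, μ.real (c i) • g i := by
  rw [integral_congr_ae (hc.ae_eq_sum_indicator hf), integral_finsetSum _ fun i hi =>
    (integrable_const (g i)).indicator₀ (hc.nullMeasurableSet i hi)]
  refine sum_congr rfl fun i hi => ?_
  rw [integral_indicator₀ (hc.nullMeasurableSet i hi), setIntegral_const]

theorem card_smul_integral [IsProbabilityMeasure μ] (hc : IsAEPartition μ s c) {p : ℝ}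
    (hp : ∀ i ∈ s, μ.real (c i) = p) (hf : ∀ i ∈ s, ∀ ω ∈ c i, f ω = g i) :
    #s • ∫ ω, f ω ∂μ = ∑ i ∈ s, g i := by
  have total : (#s : ℝ) * p = 1 := by
    have := hc.integral_eq_sum (f := fun _ => (1 : ℝ)) (g := fun _ => 1)
      fun _ _ _ _ => rfl
    rw [integral_const, probReal_univ, sum_congr rfl fun i hi => by rw [hp i hi]] at this
    simpa using this.symm
  rw [hc.integral_eq_sum hf, sum_congr rfl fun i hi => by rw [hp i hi], ← smul_sum,
    ← Nat.cast_smul_eq_nsmul ℝ, smul_smul, total, one_smul]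

end IsAEPartition

/-! ### Moments of the contents of the added boxes -/

section Moments

variable {n k : ℕ} {Ω : Type*} [MeasurableSpace Ω] {μ : Measure Ω}

theorem isUniform_append [IsProbabilityMeasure μ] {A : Fin n → Ω → ℝ} {B : Fin k → Ω → ℝ}
    (hA : ∀ i, pdf.IsUniform (A i) (Set.Icc (0 : ℝ) 1) μ volume) (hA_indep : iIndepFun A μ)
    (hB : pdf.IsUniform (fun ω i => B i ω) (orderedCube k) μ volume)
    (hAB : IndepFun (fun ω i => A i ω) (fun ω i => B i ω) μ) :
    pdf.IsUniform (fun ω => Fin.append (A · ω) (B · ω)) (tailCube n k) μ volume := by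
  have hA_cube : pdf.IsUniform (fun ω i => A i ω) (unitCube n) μ volume :=
    isUniform_pi_Icc hA hA_indep
  have cube_ne_zero : volume (unitCube n) ≠ 0 := volume_unitCube ▸ one_ne_zero
  have cube_ne_top : volume (unitCube n) ≠ ⊤ := volume_unitCube ▸ ENNReal.one_ne_top
  refine isUniform_comp (measurePreserving_append (α := ℝ)) measurableSet_tailCube
    ((hA_cube.aemeasurable cube_ne_zero cube_ne_top).prodMk
      (hB.aemeasurable volume_orderedCube_ne_zero volume_orderedCube_ne_top)) ?_
  rw [append_preimage_tailCube]
  exact isUniform_prodMk cube_ne_zero cube_ne_top volume_orderedCube_ne_zero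
    volume_orderedCube_ne_top hA_cube hB hAB

theorem isAEPartition_preimage_orderCell {Z : Ω → Fin (n + k) → ℝ}
    (hZ : pdf.IsUniform Z (tailCube n k) μ volume) :
    IsAEPartition μ (tailIncreasing n k) fun σ => Z ⁻¹' orderCell σ := by
  have aemeasurable := hZ.aemeasurable volume_tailCube_ne_zero volume_tailCube_ne_top
  refine ⟨fun σ _ => aemeasurable.nullMeasurableSet_preimage (measurableSet_orderCell σ),
    fun σ _ τ _ hne => (pairwise_disjoint_orderCell hne).preimage Z,
    ae_of_ae_map (p := fun z => ∃ σ ∈ tailIncreasing n k, z ∈ orderCell σ) aemeasurable ?_⟩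
  rw [hZ]
  exact Measure.ae_smul_measure ae_exists_mem_orderCell _

theorem measureReal_preimage_orderCell {Z : Ω → Fin (n + k) → ℝ}
    (hZ : pdf.IsUniform Z (tailCube n k) μ volume) {σ : Perm (Fin (n + k))}
    (hσ : σ ∈ tailIncreasing n k) :
    μ.real (Z ⁻¹' orderCell σ) =
      (volume (orderCell (1 : Perm (Fin (n + k)))) / volume (orderedCube k)).toReal := by
  rw [Measure.real, hZ.measure_preimage volume_tailCube_ne_zero volume_tailCube_ne_top
    (measurableSet_orderCell σ), Set.inter_eq_right.2 (orderCell_subset_tailCube hσ),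
    volume_orderCell, volume_tailCube]

theorem rskShape_ofFn_comp {m N : ℕ} {z : Fin N → ℝ} {σ : Perm (Fin N)}
    (hz : z ∈ orderCell σ) (f : Fin m → Fin N) :
    rskShape (List.ofFn (z ∘ f)) = rskShape (List.ofFn fun i => (σ (f i) : ℕ)) := by
  have map_inv : List.ofFn (z ∘ f) =
      (List.ofFn (σ ∘ f)).map (z ∘ (σ⁻¹ : Perm (Fin N))) := by
    rw [List.map_ofFn]
    congr 1
    ext i
    simp
  rw [map_inv, rskShape_map hz.2, ← rskShape_map Fin.val_strictMono, List.map_ofFn]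
  rfl

theorem coe_skewBoxes_ofFn {a : Fin n → ℝ} {b : Fin k → ℝ} {σ : Perm (Fin (n + k))}
    (hσ : Fin.append a b ∈ orderCell σ) :
    (skewBoxes (rskShape (List.ofFn a)) (rskShape (List.ofFn a ++ List.ofFn b)) : Set (ℕ × ℕ)) =
      Set.range fun i : Fin k => stepBox (recordingPath (permWord σ)) (n + i) := by
  have inner : rskShape (List.ofFn a) =
      rskShape (List.ofFn fun i => (σ (Fin.castAdd k i) : ℕ)) := by
    rw [← rskShape_ofFn_comp hσ]
    simp only [Function.comp_def, Fin.append_left]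
  have outer : rskShape (List.ofFn a ++ List.ofFn b) = rskShape (permWord σ) := by
    rw [← List.ofFn_fin_append]
    exact rskShape_ofFn_comp hσ id
  have word_split : permWord σ = (List.ofFn fun i => (σ (Fin.castAdd k i) : ℕ)) ++
      List.ofFn fun i => (σ (Fin.natAdd n i) : ℕ) := List.ofFn_add
  rw [inner, outer, word_split, coe_skewBoxes_rskShape, List.length_ofFn, List.length_ofFn,
    range_stepBox]

theorem eval_box_eq_contentEval {P : MvPolynomial (Fin k) ℂ} (hP : P.IsSymmetric)
    {a : Fin n → ℝ} {b : Fin k → ℝ} {σ : Perm (Fin (n + k))} (hσ : Fin.append a b ∈ orderCell σ)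
    (box : Fin k ≃ skewBoxes (rskShape (List.ofFn a)) (rskShape (List.ofFn a ++ List.ofFn b))) :
    MvPolynomial.eval (fun i => (uCoord (box i) : ℂ)) P =
      contentEval n P (recordingPath (permWord σ)) := by
  refine eval_uCoord_eq_contentEval hP (Subtype.val_injective.comp box.injective) ?_
  rw [← coe_skewBoxes_ofFn hσ]
  exact (box.surjective.range_comp Subtype.val).trans Subtype.range_coe

end Moments

end PieriGrowth

theorem mainTheorem10 (n k : ℕ) (hn : 1 ≤ n) (hk : 1 ≤ k)
    {Ω : Type*} [MeasurableSpace Ω] (μ : Measure Ω) [IsProbabilityMeasure μ]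
    -- `A₁, …, A_n` are i.i.d. `U(0,1)`, and `B` is independent of them and uniformly distributed
    -- on the set of increasing sequences
    (A : Fin n → Ω → ℝ) (B : Fin k → Ω → ℝ)
    (hA_unif : ∀ i, pdf.IsUniform (A i) (Set.Icc (0 : ℝ) 1) μ volume)
    (hA_indep : iIndepFun A μ)
    (hB_unif : pdf.IsUniform (fun ω i => B i ω) (orderedCube k) μ volume)
    (hAB_indep : IndepFun (fun ω i => A i ω) (fun ω i => B i ω) μ)
    -- the Pieri growth pair
    (Lam Gam : Ω → YoungDiagram)
    (hLam : ∀ ω, Lam ω = rskShape (List.ofFn fun i => A i ω))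
    (hGam : ∀ ω, Gam ω =
      rskShape ((List.ofFn fun i => A i ω) ++ (List.ofFn fun i => B i ω)))
    -- an arbitrary enumeration of the `k` boxes of `Gam ∖ Lam`
    (box : ∀ ω, Fin k ≃ skewBoxes (Lam ω) (Gam ω))
    (P : MvPolynomial (Fin k) ℂ) (hP : P.IsSymmetric) :
    Integrable (fun ω => MvPolynomial.eval (fun i => (uCoord (box ω i) : ℂ)) P) μ ∧
    ∫ ω, MvPolynomial.eval (fun i => (uCoord (box ω i) : ℂ)) P ∂μ =
      charApply (tensorChar (chiReg (Equiv.Perm (Fin n))) (chiTriv (Equiv.Perm (Fin k))))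
        (restrictYoung (evalJucysMurphy n P)) := by
  obtain rfl : Lam = _ := funext hLam
  obtain rfl : Gam = _ := funext hGam
  have uniform := isUniform_append hA_unif hA_indep hB_unif hAB_indep
  have partition := isAEPartition_preimage_orderCell uniform
  have eval_eq (σ) (_ : σ ∈ tailIncreasing n k) (ω)
      (hω : Fin.append (A · ω) (B · ω) ∈ orderCell σ) :
      MvPolynomial.eval (fun i => (uCoord (box ω i) : ℂ)) P =
        contentEval n P (recordingPath (permWord σ)) :=
    eval_box_eq_contentEval hP hω (box ω)
  have average := partition.card_smul_integral
    (fun σ hσ => measureReal_preimage_orderCell uniform hσ) eval_eq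
  rw [sum_tailIncreasing_contentEval hP, nsmul_eq_mul] at average
  exact ⟨partition.integrable eval_eq,
    mul_left_cancel₀
      (Nat.cast_ne_zero.2 (Finset.card_ne_zero_of_mem one_mem_tailIncreasing)) average⟩
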